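/- **Definitions.** Let $\mathbb F$ be a field and let $\preceq$ be a linear order on a set of variables. *OFPC.* A noncommutative formula is a binary tree with leaves labelled by variables or elements of $\mathbb F$ and with inner nodes labelled $+$ or $\times$; it computes a noncommutative polynomial, and its size is its number of nodes. For a commutative polynomial $f$ let $[\![ f]\!]$ be the noncommutative polynomial obtained by writing the variables of each monomial in nondecreasing order. A formula is *ordered* if each of its subformulas computes a polynomial of the form $[\![ f]\!]$, and an ordered formula computing $[\![ f]\!]$ is said to compute $f$. It is a (depth-3) $\Sigma\Pi\Sigma$ formula if every path from the root to a leaf starts with a plus gate and alternates at most twice between plus and product gates. A polynomial calculus (PC) refutation of a set $Q$ of polynomials is a finite sequence of polynomials ending with $1$, each of which is in $Q$, or is $x(1-x)$ for a variable $x$, or is $x\cdot p$ or $a p+b q$ for earlier lines $p,q$, a variable $x$ and $a,b\in\mathbb F$. An *OFPC refutation* of $Q$ is a sequence of ordered formulas computing, line by line, the polynomials of a PC refutation of $Q$; its size is the total size of its formulas. A CNF formula $K$ is translated to the set of the polynomials $\prod_{x\in C}(x-1)\cdot\prod_{\neg x\in C}x$, for the clauses $C$ of $K$. *$R^0(\mathrm{lin})$.*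 Lines are finite disjunctions (without repetitions) of linear equations $\sum_i a_ix_i=b$ with integer coefficients. An $R(\mathrm{lin})$ refutation of a CNF formula $K$ is a finite sequence of such disjunctions ending with the empty one, each of which is the translation $\bigvee_{x\in C}(x=1)\vee\bigvee_{\neg x\in C}(x=0)$ of a clause $C$ of $K$, or $(x=0)\vee(x=1)$ for a variable $x$, or follows from earlier lines by one of the rules: from $A\vee L_1$ and $B\vee L_2$ derive $A\vee B\vee(L_1+L_2)$ or $A\vee B\vee(L_1-L_2)$; from $A$ derive $A\vee L$; from $A\vee(0=k)$ with $k\neq0$ derive $A$. Its size is the sum of the absolute values of all coefficients and free terms in it. An $R_{c,d}(\mathrm{lin})$-line is a disjunction in which all coefficients of variables have absolute value at most $c$ (the free terms are unbounded) and which is a disjunction of $d$ (possibly empty) disjunctions, each consisting of equations that differ only in their free terms or being the translation of a clause. A family of $R^0(\mathrm{lin})$ refutations is a family of $R(\mathrm{lin})$ refutations for which there are constants $c,d$ such that all lines of all its members are $R_{c,d}(\mathrm{lin})$-lines. **Theorem.** For any linear order on the variables and over large enough fields, OFPC polynomially simulates $R^0(\mathrm{lin})$, by proofs that use only $\Sigma\Pi\Sigma$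 ordered formulas. That is: for all $c,d\in\mathbb N$ there are polynomials $p,q\in\mathbb N[X]$ such that for every field $\mathbb F$, every set of variables with a linear order $\preceq$, every CNF formula $K$ over these variables and every $R(\mathrm{lin})$ refutation of $K$ of size $s$ all of whose lines are $R_{c,d}(\mathrm{lin})$-lines, if $|\mathbb F|>q(s)$, then the polynomial translation of $K$ over $\mathbb F$ has an OFPC refutation (with respect to $\preceq$) of size at most $p(s)$ in which every formula is a $\Sigma\Pi\Sigma$ ordered formula. -/

import Mathlib

namespace OrderedPC

universe u v

noncomputable section

/-! ## Noncommutative formulas -/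

/-- Noncommutative algebraic formulas over `F` with variables in `V`: ordered binary trees whose
leaves are labelled by a variable or a field element and whose inner nodes are plus or product
gates. -/
inductive Formula (F : Type u) (V : Type v) : Type (max u v)
  | var : V → Formula F V
  | const : F → Formula F V
  | add : Formula F V → Formula F V → Formula F V
  | mul : Formula F V → Formula F V → Formula F V

namespace Formula

variable {F : Type u} {V : Type v}

/-- The size of a formula: the number of nodes of its tree. -/
def size : Formula F V → ℕ
  | var _ => 1
  | const _ => 1
  | add f g => f.size + g.size + 1
  | mul f g => f.size + g.size + 1

/-- The noncommutative polynomial in `F⟨V⟩` computed by a formula. -/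
def eval [Field F] : Formula F V → FreeAlgebra F V
  | var x => FreeAlgebra.ι F x
  | const a => algebraMap F (FreeAlgebra F V) a
  | add f g => f.eval + g.eval
  | mul f g => f.eval * g.eval

/-- `Subformula g f`: `g` is a subformula (a rooted subtree) of `f`. -/
inductive Subformula : Formula F V → Formula F V → Prop
  | refl (f : Formula F V) : Subformula f f
  | add_left {h f : Formula F V} (g : Formula F V) : Subformula h f → Subformula h (add f g)
  | add_right {h g : Formula F V} (f : Formula F V) : Subformula h g → Subformula h (add f g)
  | mul_left {h f : Formula F V} (g : Formula F V) : Subformula h f → Subformula h (mul f g)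
  | mul_right {h g : Formula F V} (f : Formula F V) : Subformula h g → Subformula h (mul f g)

/-- Formulas that contain no product gate. -/
inductive IsSigma : Formula F V → Prop
  | var (x : V) : IsSigma (var x)
  | const (a : F) : IsSigma (const a)
  | add {f g : Formula F V} : IsSigma f → IsSigma g → IsSigma (add f g)

/-- Trees of product gates over formulas without product gates: on every path from the root all
product gates precede all plus gates. -/
inductive IsPiSigma : Formula F V → Prop
  | sigma {f : Formula F V} : IsSigma f → IsPiSigma f
  | mul {f g : Formula F V} : IsPiSigma f → IsPiSigma g → IsPiSigma (mul f g)

/-- Trees of plus gates over formulas satisfying `IsPiSigma`. -/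
inductive IsSumPiSigma : Formula F V → Prop
  | piSigma {f : Formula F V} : IsPiSigma f → IsSumPiSigma f
  | add {f g : Formula F V} : IsSumPiSigma f → IsSumPiSigma g → IsSumPiSigma (add f g)

/-- Depth-3 (`ΣΠΣ`) formulas: every path from the root to a leaf starts with a plus gate, and it
alternates at most twice between plus and product gates. -/
def IsSigmaPiSigma (f : Formula F V) : Prop :=
  ∃ g h : Formula F V, f = add g h ∧ IsSumPiSigma g ∧ IsSumPiSigma h

end Formula

/-! ## Ordered polynomials and ordered formulas

The linear order on the variables is the instance `LinearOrder V`. -/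

section Ordered

variable {F : Type u} [Field F] {V : Type v} [LinearOrder V]

/-- The noncommutative monomial in which the variables of `m` (with multiplicity) are multiplied
in nondecreasing order. -/
def orderedMonomial (F : Type u) [Field F] {V : Type v} [LinearOrder V] (m : V →₀ ℕ) :
    FreeAlgebra F V :=
  (((Finsupp.toMultiset m).sort (· ≤ ·)).map (FreeAlgebra.ι F)).prod

/-- The map `⟦·⟧` from commutative to noncommutative polynomials that orders every monomial. -/
def orderedPoly (f : MvPolynomial V F) : FreeAlgebra F V :=
  ∑ m ∈ f.support, MvPolynomial.coeff m f • orderedMonomial F m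

/-- An ordered formula: every subformula computes an ordered polynomial, that is, one in the image
of `⟦·⟧`. -/
def Formula.IsOrdered (f : Formula F V) : Prop :=
  ∀ g : Formula F V, Formula.Subformula g f → ∃ p : MvPolynomial V F, g.eval = orderedPoly p

/-- The formula `f` is an ordered formula computing the commutative polynomial `p`. -/
def Formula.OrderedComputes (f : Formula F V) (p : MvPolynomial V F) : Prop :=
  f.IsOrdered ∧ f.eval = orderedPoly p

end Ordered

/-! ## Derivations as sequences of lines -/

/-- `π` is a proof of `g`: its last line is `g`, and each line `a` is permitted by `step l a`,
where `l` is the list of the lines before it. -/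
def IsSequentialProof {α : Type*} (step : List α → α → Prop) (π : List α) (g : α) : Prop :=
  π.getLast? = some g ∧ ∀ (l : List α) (a : α) (r : List α), π = l ++ a :: r → step l a

/-! ## Polynomial calculus, and polynomial calculus over ordered formulas -/

section PC

variable {F : Type u} [Field F] {V : Type v}

/-- A line of a polynomial calculus proof from `Q`, given the list `l` of the lines before it. -/
inductive PCStep (Q : Set (MvPolynomial V F)) (l : List (MvPolynomial V F)) :
    MvPolynomial V F → Prop
  | initial {p : MvPolynomial V F} : p ∈ Q → PCStep Q l p
  | boolean (x : V) : PCStep Q l (MvPolynomial.X x * (1 - MvPolynomial.X x))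
  | product {p : MvPolynomial V F} (x : V) : p ∈ l → PCStep Q l (MvPolynomial.X x * p)
  | addition {p q : MvPolynomial V F} (a b : F) : p ∈ l → q ∈ l →
      PCStep Q l (MvPolynomial.C a * p + MvPolynomial.C b * q)

/-- `π` is a polynomial calculus proof of `g` from `Q`. -/
def IsPCProof (Q : Set (MvPolynomial V F)) (π : List (MvPolynomial V F))
    (g : MvPolynomial V F) : Prop :=
  IsSequentialProof (PCStep Q) π g

/-- `φ` is an OFPC proof of `g` from `Q`: a polynomial calculus proof whose lines are written as
ordered formulas. -/
def IsOFPCProof [LinearOrder V] (Q : Set (MvPolynomial V F)) (φ : List (Formula F V))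
    (g : MvPolynomial V F) : Prop :=
  ∃ π : List (MvPolynomial V F), IsPCProof Q π g ∧ List.Forall₂ Formula.OrderedComputes φ π

/-- An OFPC refutation of `Q` is an OFPC proof of `1` from `Q`. -/
def IsOFPCRefutation [LinearOrder V] (Q : Set (MvPolynomial V F)) (φ : List (Formula F V)) :
    Prop :=
  IsOFPCProof Q φ 1

/-- The size of an OFPC proof: the total size of its formulas. -/
def ofpcSize (φ : List (Formula F V)) : ℕ :=
  (φ.map Formula.size).sum

end PC

/-! ## CNF formulas -/

/-- A literal: `(x, true)` is the literal `x`, and `(x, false)` is the literal `¬ x`. -/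
abbrev Literal (V : Type v) : Type v := V × Bool

/-- A clause: the disjunction of a finite set of literals. -/
abbrev Clause (V : Type v) : Type v := Finset (Literal V)

/-- A CNF formula: the conjunction of a finite set of clauses. -/
abbrev CNF (V : Type v) : Type v := Finset (Clause V)

/-- The polynomial translation of a clause: the product of `x - 1` over its positive literals `x`
and of `x` over its negative literals `¬ x`. -/
def clausePoly (F : Type u) [Field F] {V : Type v} (κ : Clause V) : MvPolynomial V F :=
  ∏ l ∈ κ, (MvPolynomial.X l.1 - if l.2 then 1 else 0)

/-- The polynomial translation of a CNF formula. -/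
def cnfPolys (F : Type u) [Field F] {V : Type v} (K : CNF V) : Set (MvPolynomial V F) :=
  {p | ∃ κ ∈ K, p = clausePoly F κ}

/-! ## Resolution over linear equations: R(lin) and R⁰(lin) -/

/-- The linear equation `∑ x, a x * x = b` with integer coefficients, as the pair `(a, b)` of its
linear form and its free term. Addition and subtraction are componentwise. -/
abbrev LinEq (V : Type v) : Type v := (V →₀ ℤ) × ℤ

/-- A disjunction of linear equations; duplicates are discarded. -/
abbrev LinDisj (V : Type v) : Type v := Finset (LinEq V)

section RLin

variable {V : Type v}

/-- The size of a linear equation: the sum of the absolute values of its coefficients and of its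
free term (numbers are written in unary). -/
def linEqSize (L : LinEq V) : ℕ :=
  (∑ x ∈ L.1.support, (L.1 x).natAbs) + L.2.natAbs

/-- The size of a disjunction: the total size of its equations. -/
def linDisjSize (D : LinDisj V) : ℕ :=
  ∑ L ∈ D, linEqSize L

/-- The size of an R(lin) proof: the total size of its lines. -/
def rlinSize (P : List (LinDisj V)) : ℕ :=
  (P.map linDisjSize).sum

variable [DecidableEq V]

/-- The equation of a literal: `x = 1` for the literal `x`, and `x = 0` for `¬ x`. -/
def literalEq (l : Literal V) : LinEq V :=
  (Finsupp.single l.1 1, if l.2 then 1 else 0)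

/-- The translation of a clause into a disjunction of linear equations. -/
def clauseDisj (κ : Clause V) : LinDisj V :=
  κ.image literalEq

/-- A line of an R(lin) proof from `H`, given the list `l` of the lines before it. Here
`insert L A` is the disjunction `A ∨ L`. -/
inductive RLinStep (H : Set (LinDisj V)) (l : List (LinDisj V)) : LinDisj V → Prop
  | initial {D : LinDisj V} : D ∈ H → RLinStep H l D
  | boolean (x : V) : RLinStep H l {(Finsupp.single x 1, 0), (Finsupp.single x 1, 1)}
  | resolution_add {A B : LinDisj V} {L₁ L₂ : LinEq V} : insert L₁ A ∈ l → insert L₂ B ∈ l →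
      RLinStep H l (insert (L₁ + L₂) (A ∪ B))
  | resolution_sub {A B : LinDisj V} {L₁ L₂ : LinEq V} : insert L₁ A ∈ l → insert L₂ B ∈ l →
      RLinStep H l (insert (L₁ - L₂) (A ∪ B))
  | weakening {A : LinDisj V} (L : LinEq V) : A ∈ l → RLinStep H l (insert L A)
  | simplification {A : LinDisj V} {k : ℤ} : k ≠ 0 → insert (0, k) A ∈ l → RLinStep H l A

/-- `P` is an R(lin) proof of `D` from `H`. -/
def IsRLinProof (H : Set (LinDisj V)) (P : List (LinDisj V)) (D : LinDisj V) : Prop :=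
  IsSequentialProof (RLinStep H) P D

/-- `P` is an R(lin) refutation of the CNF formula `K`: a proof of the empty disjunction from the
translations of the clauses of `K`. -/
def IsRLinRefutation (K : CNF V) (P : List (LinDisj V)) : Prop :=
  IsRLinProof {D | ∃ κ ∈ K, D = clauseDisj κ} P ∅

/-- An `R_{c,d}(lin)`-line: the coefficients of the variables have absolute value at most `c` (the
free terms are unbounded), and the disjunction is made up of `d` (possibly empty) disjunctions, each
of which consists of equations that differ only in their free terms or is the translation of a
clause. -/
def IsRcdLine (c d : ℕ) (D : LinDisj V) : Prop :=
  (∀ L ∈ D, ∀ x : V, (L.1 x).natAbs ≤ c) ∧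
  ∃ E : Fin d → LinDisj V, D = Finset.univ.biUnion E ∧
    ∀ i, (∀ L ∈ E i, ∀ L' ∈ E i, L.1 = L'.1) ∨ ∃ κ : Clause V, E i = clauseDisj κ

/-- `P` is an R(lin) refutation of `K` all of whose lines are `R_{c,d}(lin)`-lines. A family of
R⁰(lin) refutations of CNF formulas `K n` is a family of `P n` for which there are constants `c` and
`d`, not depending on `n`, such that `IsR0Refutation c d (K n) (P n)` for all `n`. -/
def IsR0Refutation (c d : ℕ) (K : CNF V) (P : List (LinDisj V)) : Prop :=
  IsRLinRefutation K P ∧ ∀ D ∈ P, IsRcdLine c d D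

end RLin

end

end OrderedPC

namespace OrderedPC

universe u v

/-! ### Compatibility of `⟦·⟧` with sums and with products in increasing order of variables. -/

section OrderedFormulas

variable {F : Type u} [Field F] {V : Type v} [LinearOrder V]

/-! Every line `D` is replaced by a polynomial that is `0` on the Boolean assignments satisfying `D`
and `1` on the others. These polynomials, and all intermediate ones, are kept as short sums of
products of univariate linear polynomials `a + b x`. Such a sum suits every order of the variables:
commutativity lets the factors of each product be sorted, which gives an ordered ΣΠΣ formula
(`IsLinProdSum.exists_formula`).

Representation (`exists_isLinProdSum_linVal`, `IsRcdLine.exists_represents`). Equations with a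
common linear form `a` depend only on the value of `a`, which ranges over at most `2s + 1` integers.
Given `2s + 1` distinct field elements `t`, Vandermonde interpolation writes any function of this
value as a combination of the exponentials `t ^ (∑ a x * x)`. On the cube each exponential is a
product of univariate linear factors. Clauses translate directly into one product, and the `d` parts
of a line are multiplied together.

Simulation (`DerivableIn.of_represents`). If `C` follows semantically from `A` and `B`, then `pC =
pC * pA + pC * (1 - pA) * pB` on the cube. The right-hand side is derivable by multiplying earlier
lines. The difference of the two sides vanishes on the cube, and every short sum of products with
this property has a short derivation (`DerivableIn.of_vanishing`): the Boolean axioms make each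
product multilinear, and the multilinear versions then cancel identically. -/

theorem orderedPoly_eq_sum {f : MvPolynomial V F} {s : Finset (V →₀ ℕ)} (h : f.support ⊆ s) :
    orderedPoly f = ∑ m ∈ s, MvPolynomial.coeff m f • orderedMonomial F m := by
  refine Finset.sum_subset h fun m _ hm => ?_
  rw [MvPolynomial.notMem_support_iff.mp hm, zero_smul]

theorem orderedPoly_add (f g : MvPolynomial V F) :
    orderedPoly (f + g) = orderedPoly f + orderedPoly g := by
  classical
  rw [orderedPoly_eq_sum (MvPolynomial.support_add (p := f) (q := g)),
    orderedPoly_eq_sum (Finset.subset_union_left (s₁ := f.support) (s₂ := g.support)),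
    orderedPoly_eq_sum (Finset.subset_union_right (s₁ := f.support) (s₂ := g.support)),
    ← Finset.sum_add_distrib]
  simp [add_smul]

theorem orderedPoly_zero : orderedPoly (0 : MvPolynomial V F) = 0 := by
  simp [orderedPoly]

theorem orderedPoly_sum {ι : Type*} (s : Finset ι) (f : ι → MvPolynomial V F) :
    orderedPoly (∑ i ∈ s, f i) = ∑ i ∈ s, orderedPoly (f i) := by
  classical
  induction s using Finset.induction_on with
  | empty => simp [orderedPoly_zero]
  | insert i s hi ih => rw [Finset.sum_insert hi, Finset.sum_insert hi, orderedPoly_add, ih]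

theorem orderedPoly_monomial (m : V →₀ ℕ) (a : F) :
    orderedPoly (MvPolynomial.monomial m a) = a • orderedMonomial F m := by
  classical
  rw [orderedPoly_eq_sum (MvPolynomial.support_monomial_subset)]
  simp

theorem orderedPoly_C (a : F) :
    orderedPoly (MvPolynomial.C a : MvPolynomial V F) = algebraMap F (FreeAlgebra F V) a := by
  rw [MvPolynomial.C_apply, orderedPoly_monomial]
  simp [orderedMonomial, Algebra.algebraMap_eq_smul_one]

theorem orderedPoly_X (x : V) :
    orderedPoly (MvPolynomial.X x : MvPolynomial V F) = FreeAlgebra.ι F x := by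
  rw [MvPolynomial.X, orderedPoly_monomial]
  simp [orderedMonomial]

/-- Under `h` the concatenation of the two sorted lists is sorted, and a sorted list is determined
by its multiset. -/
theorem orderedMonomial_add {m n : V →₀ ℕ} (h : ∀ x ∈ m.support, ∀ y ∈ n.support, x ≤ y) :
    orderedMonomial F (m + n) = orderedMonomial F m * orderedMonomial F n := by
  rw [orderedMonomial, orderedMonomial, orderedMonomial, ← List.prod_append, ← List.map_append]
  congr 2
  refine List.Perm.eq_of_pairwise' (r := (· ≤ ·)) (Multiset.pairwise_sort _ _) ?_ ?_
  · rw [List.pairwise_append]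
    refine ⟨Multiset.pairwise_sort _ _, Multiset.pairwise_sort _ _, fun x hx y hy => h x ?_ y ?_⟩
    · simpa using hx
    · simpa using hy
  · rw [← Multiset.coe_eq_coe, ← Multiset.coe_add]
    simp

/-- The inequality is not strict, so the two factors may share a variable; products with several
factors in one variable are therefore still ordered. -/
theorem orderedPoly_mul {p q : MvPolynomial V F} (h : ∀ x ∈ p.vars, ∀ y ∈ q.vars, x ≤ y) :
    orderedPoly (p * q) = orderedPoly p * orderedPoly q := by
  conv_lhs => rw [p.as_sum, q.as_sum]
  rw [Finset.sum_mul_sum, orderedPoly_sum, orderedPoly, orderedPoly, Finset.sum_mul_sum]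
  refine Finset.sum_congr rfl fun m hm => ?_
  rw [orderedPoly_sum]
  refine Finset.sum_congr rfl fun n hn => ?_
  rw [MvPolynomial.monomial_mul, orderedPoly_monomial, orderedMonomial_add, smul_mul_smul_comm]
  intro x hx y hy
  exact h x ((MvPolynomial.mem_vars_iff_mem_support x).mpr ⟨m, hm, hx⟩) y
    ((MvPolynomial.mem_vars_iff_mem_support y).mpr ⟨n, hn, hy⟩)

namespace Formula

theorem OrderedComputes.const (a : F) :
    OrderedComputes (Formula.const a : Formula F V) (MvPolynomial.C a) := by
  refine ⟨fun g hg => ?_, (orderedPoly_C a).symm⟩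
  cases hg
  exact ⟨_, (orderedPoly_C a).symm⟩

theorem OrderedComputes.var (x : V) :
    OrderedComputes (Formula.var x : Formula F V) (MvPolynomial.X x) := by
  refine ⟨fun g hg => ?_, (orderedPoly_X x).symm⟩
  cases hg
  exact ⟨_, (orderedPoly_X x).symm⟩

theorem OrderedComputes.add {f g : Formula F V} {p q : MvPolynomial V F}
    (hf : OrderedComputes f p) (hg : OrderedComputes g q) :
    OrderedComputes (Formula.add f g) (p + q) := by
  have key : (Formula.add f g).eval = orderedPoly (p + q) := by
    rw [orderedPoly_add, ← hf.2, ← hg.2, Formula.eval]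
  refine ⟨fun e he => ?_, key⟩
  cases he with
  | refl => exact ⟨_, key⟩
  | add_left _ h => exact hf.1 _ h
  | add_right _ h => exact hg.1 _ h

theorem OrderedComputes.mul {f g : Formula F V} {p q : MvPolynomial V F}
    (hf : OrderedComputes f p) (hg : OrderedComputes g q)
    (h : ∀ x ∈ p.vars, ∀ y ∈ q.vars, x ≤ y) :
    OrderedComputes (Formula.mul f g) (p * q) := by
  have key : (Formula.mul f g).eval = orderedPoly (p * q) := by
    rw [orderedPoly_mul h, ← hf.2, ← hg.2, Formula.eval]
  refine ⟨fun e he => ?_, key⟩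
  cases he with
  | refl => exact ⟨_, key⟩
  | mul_left _ h => exact hf.1 _ h
  | mul_right _ h => exact hg.1 _ h

end Formula

end OrderedFormulas

/-! ## Sums of products of univariate linear polynomials -/

section LinearProducts

variable {F : Type u} [Field F] {V : Type v}

/-- The univariate linear polynomial `a + b x` given by the triple `(x, a, b)`. -/
noncomputable def linPoly (i : V × F × F) : MvPolynomial V F :=
  MvPolynomial.C i.2.1 + MvPolynomial.C i.2.2 * MvPolynomial.X i.1

/-- The product of a list of univariate linear polynomials. -/
noncomputable def linProd (l : List (V × F × F)) : MvPolynomial V F :=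
  (l.map linPoly).prod

/-- The sum of scalar multiples of products of univariate linear polynomials. -/
noncomputable def linProdSum (T : List (F × List (V × F × F))) : MvPolynomial V F :=
  (T.map fun t => MvPolynomial.C t.1 * linProd t.2).sum

/-- `p` is a sum of at most `K` terms, each of which is a scalar multiple of a product of at most
`L` univariate linear polynomials. -/
def IsLinProdSum (K L : ℕ) (p : MvPolynomial V F) : Prop :=
  ∃ T : List (F × List (V × F × F)),
    T.length ≤ K ∧ (∀ t ∈ T, t.2.length ≤ L) ∧ linProdSum T = p

open Classical in
/-- A formula for a univariate linear polynomial in which the product gate is on top. -/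
noncomputable def linFormula (i : V × F × F) : Formula F V :=
  if i.2.2 = 0 then .const i.2.1
  else .mul (.const i.2.2) (.add (.var i.1) (.const (i.2.1 / i.2.2)))

/-- The product formula of a scalar multiple of a product of univariate linear polynomials. -/
noncomputable def termFormula (a : F) : List (V × F × F) → Formula F V
  | [] => .const a
  | i :: l => .mul (linFormula i) (termFormula a l)

/-- The formula of a sum of products of univariate linear polynomials. -/
noncomputable def sumFormula : List (F × List (V × F × F)) → Formula F V
  | [] => .add (.const 0) (.const 0)
  | t :: T => .add (termFormula t.1 t.2) (sumFormula T)

theorem size_linFormula_le (i : V × F × F) : (linFormula i).size ≤ 5 := by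
  unfold linFormula
  split_ifs <;> simp [Formula.size]

theorem size_termFormula_le (a : F) (l : List (V × F × F)) :
    (termFormula a l).size ≤ 6 * l.length + 1 := by
  induction l with
  | nil => simp [termFormula, Formula.size]
  | cons i l ih =>
    have := size_linFormula_le i
    simp only [termFormula, Formula.size, List.length_cons]
    omega

theorem size_sumFormula_le {L : ℕ} (T : List (F × List (V × F × F)))
    (hT : ∀ t ∈ T, t.2.length ≤ L) :
    (sumFormula T).size ≤ T.length * (6 * L + 2) + 3 := by
  induction T with
  | nil => simp [sumFormula, Formula.size]
  | cons t T ih =>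
    have h1 := size_termFormula_le t.1 t.2
    have h2 := hT t (by simp)
    have h3 := ih fun t ht => hT t (by simp [ht])
    simp only [sumFormula, Formula.size, List.length_cons, add_mul]
    omega

/-- This is the reason for writing `a + b x` as `b (x + a / b)`: the product gate joins those of the
surrounding product, whereas `a + b * x` would place a product below a sum below a product. -/
theorem isPiSigma_linFormula (i : V × F × F) : (linFormula i).IsPiSigma := by
  unfold linFormula
  split_ifs
  · exact .sigma (.const _)
  · exact .mul (.sigma (.const _)) (.sigma (.add (.var _) (.const _)))

theorem isPiSigma_termFormula (a : F) (l : List (V × F × F)) : (termFormula a l).IsPiSigma := by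
  induction l with
  | nil => exact .sigma (.const _)
  | cons i l ih => exact .mul (isPiSigma_linFormula i) ih

theorem isSumPiSigma_sumFormula (T : List (F × List (V × F × F))) :
    (sumFormula T).IsSumPiSigma := by
  induction T with
  | nil => exact .piSigma (.sigma (.add (.const _) (.const _)))
  | cons t T ih => exact .add (.piSigma (isPiSigma_termFormula _ _)) ih

/-- The root has to be a plus gate; the terminal summand `0 + 0` provides one even for sums with no
or one term. -/
theorem isSigmaPiSigma_sumFormula (T : List (F × List (V × F × F))) :
    (sumFormula T).IsSigmaPiSigma := by
  cases T with
  | nil => exact ⟨_, _, rfl, .piSigma (.sigma (.const _)), .piSigma (.sigma (.const _))⟩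
  | cons t T => exact ⟨_, _, rfl, .piSigma (isPiSigma_termFormula _ _), isSumPiSigma_sumFormula T⟩

theorem linProd_cons (i : V × F × F) (l : List (V × F × F)) :
    linProd (i :: l) = linPoly i * linProd l := by
  simp [linProd]

theorem linProd_append (l l' : List (V × F × F)) :
    linProd (l ++ l') = linProd l * linProd l' := by
  simp [linProd]

theorem linProd_perm {l l' : List (V × F × F)} (h : l.Perm l') : linProd l = linProd l' :=
  (h.map _).prod_eq

theorem vars_linPoly_subset (i : V × F × F) : ∀ x ∈ (linPoly i).vars, x = i.1 := by
  classical
  intro x hx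
  have h1 := MvPolynomial.vars_add_subset _ _ hx
  simp only [MvPolynomial.vars_C, Finset.empty_union] at h1
  have h2 := MvPolynomial.vars_mul _ _ h1
  simpa [MvPolynomial.vars_X] using h2

theorem vars_C_mul_linProd_subset (a : F) (l : List (V × F × F)) :
    ∀ x ∈ (MvPolynomial.C a * linProd l).vars, ∃ i ∈ l, x = i.1 := by
  classical
  induction l with
  | nil => simp [linProd, ← MvPolynomial.C_1, -map_one, ← MvPolynomial.C_mul, MvPolynomial.vars_C]
  | cons i l ih =>
    intro x hx
    rw [linProd_cons, mul_left_comm] at hx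
    rcases Finset.mem_union.mp (MvPolynomial.vars_mul _ _ hx) with h | h
    · exact ⟨i, by simp, vars_linPoly_subset i x h⟩
    · obtain ⟨j, hj, h⟩ := ih x h
      exact ⟨j, by simp [hj], h⟩

variable [LinearOrder V]

theorem orderedComputes_linFormula (i : V × F × F) :
    (linFormula i).OrderedComputes (linPoly i) := by
  unfold linFormula linPoly
  split_ifs with h
  · simpa [h] using Formula.OrderedComputes.const (V := V) i.2.1
  · have := (Formula.OrderedComputes.const (V := V) i.2.2).mul
      ((Formula.OrderedComputes.var i.1).add (Formula.OrderedComputes.const (i.2.1 / i.2.2)))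
      (by simp [MvPolynomial.vars_C])
    rwa [mul_add, ← MvPolynomial.C_mul, mul_div_cancel₀ _ h, add_comm] at this

theorem orderedComputes_termFormula (a : F) (l : List (V × F × F))
    (hl : l.Pairwise fun i j => i.1 ≤ j.1) :
    (termFormula a l).OrderedComputes (MvPolynomial.C a * linProd l) := by
  induction l with
  | nil => simpa [linProd, termFormula] using Formula.OrderedComputes.const (V := V) a
  | cons i l ih =>
    rw [List.pairwise_cons] at hl
    rw [linProd_cons, mul_left_comm]
    refine (orderedComputes_linFormula i).mul (ih hl.2) fun x hx y hy => ?_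
    obtain ⟨j, hj, rfl⟩ := vars_C_mul_linProd_subset a l y hy
    rw [vars_linPoly_subset i x hx]
    exact hl.1 j hj

theorem orderedComputes_sumFormula (T : List (F × List (V × F × F)))
    (hT : ∀ t ∈ T, t.2.Pairwise fun i j => i.1 ≤ j.1) :
    (sumFormula T).OrderedComputes (linProdSum T) := by
  induction T with
  | nil =>
    simpa [linProdSum, sumFormula] using
      (Formula.OrderedComputes.const (V := V) (0 : F)).add (Formula.OrderedComputes.const 0)
  | cons t T ih =>
    have := (orderedComputes_termFormula t.1 t.2 (hT t (by simp))).add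
      (ih fun t ht => hT t (by simp [ht]))
    simpa [linProdSum, sumFormula] using this

/-- Sorting the factors of each product by their variable changes neither the commutative polynomial
nor the numbers of terms and factors, so the size bound does not depend on the order of the
variables. -/
theorem IsLinProdSum.exists_formula {K L : ℕ} {p : MvPolynomial V F} (h : IsLinProdSum K L p) :
    ∃ f : Formula F V, f.IsSigmaPiSigma ∧ f.OrderedComputes p ∧ f.size ≤ K * (6 * L + 2) + 3 := by
  obtain ⟨T, hK, hL, rfl⟩ := h
  let le : V × F × F → V × F × F → Prop := fun i j => i.1 ≤ j.1
  have : DecidableRel le := fun i j => inferInstanceAs (Decidable (i.1 ≤ j.1))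
  have : Std.Total le := ⟨fun i j => le_total i.1 j.1⟩
  have : IsTrans _ le := ⟨fun i j k => le_trans (a := i.1)⟩
  let T' := T.map fun t => (t.1, t.2.insertionSort le)
  have hT' : ∀ t ∈ T', t.2.length ≤ L ∧ t.2.Pairwise le := by
    intro t ht
    obtain ⟨u, hu, rfl⟩ := List.mem_map.mp ht
    exact ⟨by simpa using hL u hu, List.pairwise_insertionSort _ _⟩
  have hsum : linProdSum T' = linProdSum T := by
    simp only [linProdSum, T', List.map_map]
    congr 1
    refine List.map_congr_left fun t _ => ?_
    simp [linProd_perm (List.perm_insertionSort le t.2)]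
  refine ⟨sumFormula T', isSigmaPiSigma_sumFormula _,
    hsum ▸ orderedComputes_sumFormula T' fun t ht => (hT' t ht).2,
    (size_sumFormula_le T' fun t ht => (hT' t ht).1).trans ?_⟩
  gcongr
  simpa [T'] using hK

end LinearProducts

/-! ### Closure of sums of products under ring operations. -/

section Closure

variable {F : Type u} [Field F] {V : Type v}

theorem linProdSum_append (T T' : List (F × List (V × F × F))) :
    linProdSum (T ++ T') = linProdSum T + linProdSum T' := by
  simp [linProdSum]

theorem linProdSum_cons (t : F × List (V × F × F)) (T : List (F × List (V × F × F))) :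
    linProdSum (t :: T) = MvPolynomial.C t.1 * linProd t.2 + linProdSum T := by
  simp [linProdSum]

namespace IsLinProdSum

variable {K K' L L' : ℕ} {p q : MvPolynomial V F}

theorem mono (h : IsLinProdSum K L p) (hK : K ≤ K') (hL : L ≤ L') : IsLinProdSum K' L' p := by
  obtain ⟨T, h1, h2, h3⟩ := h
  exact ⟨T, h1.trans hK, fun t ht => (h2 t ht).trans hL, h3⟩

theorem add (hp : IsLinProdSum K L p) (hq : IsLinProdSum K' L q) :
    IsLinProdSum (K + K') L (p + q) := by
  obtain ⟨T, h1, h2, rfl⟩ := hp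
  obtain ⟨T', h1', h2', rfl⟩ := hq
  refine ⟨T ++ T', by simpa using add_le_add h1 h1', fun t ht => ?_, linProdSum_append T T'⟩
  rcases List.mem_append.mp ht with h | h
  exacts [h2 t h, h2' t h]

theorem zero : IsLinProdSum K L (0 : MvPolynomial V F) :=
  ⟨[], by simp, by simp, by simp [linProdSum]⟩

theorem C_mul_linProd (a : F) (l : List (V × F × F)) :
    IsLinProdSum 1 l.length (MvPolynomial.C a * linProd l) :=
  ⟨[(a, l)], by simp, by simp, by simp [linProdSum]⟩

theorem linProd (l : List (V × F × F)) : IsLinProdSum 1 l.length (linProd l) := by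
  simpa using C_mul_linProd 1 l

theorem C (a : F) : IsLinProdSum 1 0 (MvPolynomial.C a : MvPolynomial V F) := by
  simpa [OrderedPC.linProd] using C_mul_linProd (V := V) a []

theorem one : IsLinProdSum 1 0 (1 : MvPolynomial V F) := by
  simpa using C (V := V) (1 : F)

theorem linPoly (i : V × F × F) : IsLinProdSum 1 1 (linPoly i) := by
  simpa [OrderedPC.linProd] using linProd [i]

theorem X (x : V) : IsLinProdSum 1 1 (MvPolynomial.X x : MvPolynomial V F) := by
  simpa [OrderedPC.linPoly] using linPoly (F := F) (x, 0, 1)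

theorem C_mul_linProd_mul (a : F) (l : List (V × F × F)) (hq : IsLinProdSum K L q) :
    IsLinProdSum K (l.length + L) (MvPolynomial.C a * OrderedPC.linProd l * q) := by
  obtain ⟨T, h1, h2, rfl⟩ := hq
  refine ⟨T.map fun t => (a * t.1, l ++ t.2), by simpa using h1, ?_, ?_⟩
  · intro t ht
    obtain ⟨u, hu, rfl⟩ := List.mem_map.mp ht
    simpa using h2 u hu
  · simp only [linProdSum, List.map_map, ← List.sum_map_mul_left]
    congr 1
    refine List.map_congr_left fun t _ => ?_
    simp only [Function.comp, linProd_append, MvPolynomial.C_mul]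
    ring

theorem mul (hp : IsLinProdSum K L p) (hq : IsLinProdSum K' L' q) :
    IsLinProdSum (K * K') (L + L') (p * q) := by
  obtain ⟨T, h1, h2, rfl⟩ := hp
  suffices IsLinProdSum (T.length * K') (L + L') (linProdSum T * q) from
    this.mono (Nat.mul_le_mul_right _ h1) le_rfl
  clear h1
  induction T with
  | nil => simpa [linProdSum] using zero
  | cons t T ih =>
    rw [linProdSum_cons, add_mul, List.length_cons, add_mul, one_mul, add_comm (T.length * K')]
    exact ((C_mul_linProd_mul t.1 t.2 hq).mono le_rfl
      (Nat.add_le_add_right (h2 t (by simp)) _)).add (ih fun t ht => h2 t (by simp [ht]))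

theorem C_mul (a : F) (hp : IsLinProdSum K L p) : IsLinProdSum K L (MvPolynomial.C a * p) := by
  simpa using (C a).mul hp

theorem neg (hp : IsLinProdSum K L p) : IsLinProdSum K L (-p) := by
  simpa using hp.C_mul (-1)

theorem sub (hp : IsLinProdSum K L p) (hq : IsLinProdSum K' L q) :
    IsLinProdSum (K + K') L (p - q) := by
  simpa [sub_eq_add_neg] using hp.add hq.neg

theorem prod {ι : Type*} (s : Finset ι) (f : ι → MvPolynomial V F)
    (hf : ∀ i ∈ s, IsLinProdSum K L (f i)) :
    IsLinProdSum (K ^ s.card) (s.card * L) (∏ i ∈ s, f i) := by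
  classical
  induction s using Finset.induction_on with
  | empty => simpa using one
  | insert i s hi ih =>
    rw [Finset.prod_insert hi, Finset.card_insert_of_notMem hi, pow_succ', add_mul, one_mul,
      add_comm (s.card * L)]
    exact (hf i (by simp)).mul (ih fun j hj => hf j (by simp [hj]))

theorem sum_list (ps : List (MvPolynomial V F)) (h : ∀ p ∈ ps, IsLinProdSum K L p) :
    IsLinProdSum (ps.length * K) L ps.sum := by
  induction ps with
  | nil => simpa using zero
  | cons p ps ih =>
    rw [List.sum_cons, List.length_cons, add_mul, one_mul, add_comm (ps.length * K)]
    exact (h p (by simp)).add (ih fun q hq => h q (by simp [hq]))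

end IsLinProdSum

end Closure

/-! ## Derivability in a bounded number of lines of bounded shape -/

section Derivability

variable {F : Type u} [Field F] {V : Type v}

/-- `π` is a polynomial calculus derivation from `Q` all of whose lines are sums of at most `K`
products of at most `L` univariate linear polynomials. -/
def IsBoundedPCSeq (Q : Set (MvPolynomial V F)) (K L : ℕ) (π : List (MvPolynomial V F)) : Prop :=
  ∀ (l : List (MvPolynomial V F)) (a : MvPolynomial V F) (r : List (MvPolynomial V F)),
    π = l ++ a :: r → PCStep Q l a ∧ IsLinProdSum K L a

/-- Every bounded derivation containing `S` can be extended by at most `k` lines to one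
containing `p`. -/
def DerivableIn (Q : Set (MvPolynomial V F)) (K L k : ℕ) (S : Set (MvPolynomial V F))
    (p : MvPolynomial V F) : Prop :=
  ∀ π, IsBoundedPCSeq Q K L π → (∀ q ∈ S, q ∈ π) →
    ∃ r : List (MvPolynomial V F), r.length ≤ k ∧ IsBoundedPCSeq Q K L (π ++ r) ∧ p ∈ π ++ r

theorem IsBoundedPCSeq.concat {Q : Set (MvPolynomial V F)} {K L : ℕ} {π : List (MvPolynomial V F)}
    (hπ : IsBoundedPCSeq Q K L π) {p : MvPolynomial V F} (hp : PCStep Q π p)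
    (hp' : IsLinProdSum K L p) : IsBoundedPCSeq Q K L (π ++ [p]) := by
  intro l a r h
  rcases List.eq_nil_or_concat r with rfl | ⟨r', b, rfl⟩
  · obtain ⟨rfl, h⟩ := List.append_inj' h rfl
    obtain rfl : p = a := by simpa using h
    exact ⟨hp, hp'⟩
  · rw [List.concat_eq_append, ← List.cons_append, ← List.append_assoc] at h
    exact hπ l a r' (List.append_inj' h rfl).1

namespace DerivableIn

variable {Q : Set (MvPolynomial V F)} {K L k k' : ℕ} {S S' : Set (MvPolynomial V F)}
  {p q : MvPolynomial V F}

theorem mono (h : DerivableIn Q K L k S p) (hk : k ≤ k') : DerivableIn Q K L k' S p := by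
  intro π hπ hS
  obtain ⟨r, h1, h2⟩ := h π hπ hS
  exact ⟨r, h1.trans hk, h2⟩

theorem weaken (h : DerivableIn Q K L k S p) (hS : S ⊆ S') : DerivableIn Q K L k S' p :=
  fun π hπ h' => h π hπ fun q hq => h' q (hS hq)

theorem of_mem (h : p ∈ S) : DerivableIn Q K L 0 S p :=
  fun π hπ hS => ⟨[], by simp, by simpa using hπ, by simpa using hS p h⟩

/-- The second extension is appended to the first, whose lines stay available, so costs add up. -/
theorem trans (hp : DerivableIn Q K L k S p) (hq : DerivableIn Q K L k' (insert p S) q) :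
    DerivableIn Q K L (k + k') S q := by
  intro π hπ hS
  obtain ⟨r, h1, h2, h3⟩ := hp π hπ hS
  obtain ⟨r', h1', h2', h3'⟩ := hq (π ++ r) h2 (by
    rintro q (rfl | hq)
    · exact h3
    · exact List.mem_append_left _ (hS q hq))
  rw [List.append_assoc] at h2' h3'
  exact ⟨r ++ r', by simpa using add_le_add h1 h1', h2', h3'⟩

theorem of_step (h : ∀ π : List (MvPolynomial V F), (∀ q ∈ S, q ∈ π) → PCStep Q π p)
    (hp : IsLinProdSum K L p) : DerivableIn Q K L 1 S p :=
  fun π hπ hS => ⟨[p], by simp, hπ.concat (h π hS) hp, by simp⟩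

theorem initial (hp : p ∈ Q) (hp' : IsLinProdSum K L p) : DerivableIn Q K L 1 S p :=
  of_step (fun _ _ => .initial hp) hp'

theorem boolean (x : V)
    (hx : IsLinProdSum K L (MvPolynomial.X x * (1 - MvPolynomial.X x) : MvPolynomial V F)) :
    DerivableIn Q K L 1 S (MvPolynomial.X x * (1 - MvPolynomial.X x)) :=
  of_step (fun _ _ => .boolean x) hx

theorem X_mul (x : V) (hp : p ∈ S) (hp' : IsLinProdSum K L (MvPolynomial.X x * p)) :
    DerivableIn Q K L 1 S (MvPolynomial.X x * p) :=
  of_step (fun _ h => .product x (h p hp)) hp'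

theorem lincomb (a b : F) (hp : p ∈ S) (hq : q ∈ S)
    (h : IsLinProdSum K L (MvPolynomial.C a * p + MvPolynomial.C b * q)) :
    DerivableIn Q K L 1 S (MvPolynomial.C a * p + MvPolynomial.C b * q) :=
  of_step (fun _ h => .addition a b (h p hp) (h q hq)) h

/-- The line `0` is obtained as a trivial combination of an existing line, whence the nonemptiness
assumption here and in what builds on it. -/
theorem zero (hS : S.Nonempty) : DerivableIn Q K L 1 S 0 := by
  obtain ⟨p, hp⟩ := hS
  simpa using lincomb (Q := Q) (K := K) (L := L) 0 0 hp hp (by simpa using IsLinProdSum.zero)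

theorem C_mul (a : F) (h : DerivableIn Q K L k S p) (h' : IsLinProdSum K L p) :
    DerivableIn Q K L (k + 1) S (MvPolynomial.C a * p) := by
  have h0 : MvPolynomial.C a * p = MvPolynomial.C a * p + MvPolynomial.C 0 * p := by simp
  refine h.trans ?_
  rw [h0]
  exact lincomb a 0 (by simp) (by simp) (h0 ▸ h'.C_mul a)

theorem add (hp : DerivableIn Q K L k S p) (hq : DerivableIn Q K L k' S q)
    (h : IsLinProdSum K L (p + q)) : DerivableIn Q K L (k + k' + 1) S (p + q) := by
  have h0 : p + q = MvPolynomial.C 1 * p + MvPolynomial.C 1 * q := by simp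
  rw [add_assoc]
  refine hp.trans ((hq.weaken (Set.subset_insert _ _)).trans ?_)
  rw [h0]
  exact lincomb 1 1 (by simp) (by simp) (h0 ▸ h)

theorem sum_list {K' : ℕ} (hS : S.Nonempty) (ps : List (MvPolynomial V F))
    (h : ∀ p ∈ ps, DerivableIn Q K L k S p ∧ IsLinProdSum K' L p) (hK : ps.length * K' ≤ K) :
    DerivableIn Q K L (ps.length * (k + 1) + 1) S ps.sum := by
  induction ps with
  | nil => simpa using zero hS
  | cons p ps ih =>
    have h1 := IsLinProdSum.sum_list (p :: ps) fun p hp => (h p hp).2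
    have h2 : ps.length * K' ≤ K := by
      rw [List.length_cons, add_mul] at hK; omega
    rw [List.sum_cons] at h1 ⊢
    refine (add (h p (by simp)).1 (ih (fun q hq => h q (by simp [hq])) h2)
      (h1.mono hK le_rfl)).mono (le_of_eq ?_)
    rw [List.length_cons]
    ring

theorem linPoly_mul {K' L' : ℕ} (i : V × F × F) (h : DerivableIn Q K L k S p)
    (h' : IsLinProdSum K' L' p) (hK : K' ≤ K) (hL : L' + 1 ≤ L) :
    DerivableIn Q K L (k + 2) S (linPoly i * p) := by
  have h0 : linPoly i * p =
      MvPolynomial.C i.2.1 * p + MvPolynomial.C i.2.2 * (MvPolynomial.X i.1 * p) := by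
    rw [linPoly]; ring
  have h1 : IsLinProdSum K L (MvPolynomial.X i.1 * p) :=
    ((IsLinProdSum.X i.1).mul h').mono (by omega) (by omega)
  have h2 : IsLinProdSum K L (linPoly i * p) :=
    ((IsLinProdSum.linPoly i).mul h').mono (by omega) (by omega)
  refine h.trans ((X_mul i.1 (by simp) h1).trans (k' := 1) ?_)
  rw [h0]
  exact lincomb _ _ (by simp) (by simp) (h0 ▸ h2)

theorem linProd_mul {K' L' : ℕ} (l : List (V × F × F)) (h : DerivableIn Q K L k S p)
    (h' : IsLinProdSum K' L' p) (hK : K' ≤ K) (hL : L' + l.length ≤ L) :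
    DerivableIn Q K L (k + 2 * l.length) S (linProd l * p) := by
  induction l with
  | nil => simpa [linProd] using h
  | cons i l ih =>
    rw [List.length_cons] at hL ⊢
    rw [linProd_cons, mul_assoc]
    exact linPoly_mul (L' := l.length + L') i (ih (by omega))
      (((IsLinProdSum.linProd l).mul h').mono (by omega) le_rfl) hK (by omega)

/-- Multiples of a derivable polynomial by a sum of products are derivable. -/
theorem mul_of_mem {K₁ L₁ K₂ L₂ : ℕ} {r : MvPolynomial V F} (hr : IsLinProdSum K₁ L₁ r)
    (hq : IsLinProdSum K₂ L₂ q) (hS : q ∈ S) (hK : K₁ * K₂ ≤ K) (hK₂ : K₂ ≤ K)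
    (hL : L₁ + L₂ ≤ L) :
    DerivableIn Q K L (K₁ * (2 * L₁ + 2) + 1) S (r * q) := by
  obtain ⟨T, h1, h2, rfl⟩ := hr
  -- Per term: two lines for each of the at most `L₁` factors, and one for the scalar.
  have key := sum_list (Q := Q) (K := K) (L := L) (k := 2 * L₁ + 1) (K' := K₂) ⟨q, hS⟩
    (T.map fun t => MvPolynomial.C t.1 * (linProd t.2 * q)) (by
      intro p hp
      obtain ⟨t, ht, rfl⟩ := List.mem_map.mp hp
      have h3 := h2 t ht
      have h4 : IsLinProdSum K₂ L (linProd t.2 * q) :=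
        ((IsLinProdSum.linProd t.2).mul hq).mono (by omega) (by omega)
      refine ⟨?_, h4.C_mul _⟩
      exact (C_mul t.1 (linProd_mul t.2 (of_mem hS) hq hK₂ (by omega))
        (h4.mono hK₂ le_rfl)).mono (by omega))
    (by simpa using (Nat.mul_le_mul_right _ h1).trans hK)
  have hsum : (T.map fun t => MvPolynomial.C t.1 * (linProd t.2 * q)).sum = linProdSum T * q := by
    simp [linProdSum, ← List.sum_map_mul_right, mul_assoc]
  rw [hsum] at key
  refine key.mono ?_
  rw [List.length_map]
  gcongr

end DerivableIn

end Derivability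

/-! ### Multilinear polynomials and their values on the Boolean cube. -/

section Multilinear

variable {F : Type u} [Field F] {V : Type v}

/-- The point of `F^V` given by a Boolean assignment. -/
def cubePoint (F : Type u) [Field F] (e : V → Bool) (x : V) : F :=
  if e x then 1 else 0

open Classical in
/-- `p` is the multilinear polynomial in the variables `W` that is determined by its values on the
Boolean cube. -/
def IsMultilinearIn (W : Finset V) (p : MvPolynomial V F) : Prop :=
  p = ∑ s ∈ W.powerset,
    MvPolynomial.C (MvPolynomial.eval (cubePoint F fun x => decide (x ∈ s)) p) *
      ((∏ x ∈ s, MvPolynomial.X x) * ∏ x ∈ W \ s, (1 - MvPolynomial.X x))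

theorem IsMultilinearIn.zero (W : Finset V) : IsMultilinearIn W (0 : MvPolynomial V F) := by
  simp [IsMultilinearIn]

theorem IsMultilinearIn.add {W : Finset V} {p q : MvPolynomial V F} (hp : IsMultilinearIn W p)
    (hq : IsMultilinearIn W q) : IsMultilinearIn W (p + q) := by
  unfold IsMultilinearIn at *
  conv_lhs => rw [hp, hq]
  rw [← Finset.sum_add_distrib]
  simp [add_mul]

theorem IsMultilinearIn.C_mul {W : Finset V} {p : MvPolynomial V F} (a : F)
    (hp : IsMultilinearIn W p) : IsMultilinearIn W (MvPolynomial.C a * p) := by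
  unfold IsMultilinearIn at *
  conv_lhs => rw [hp]
  rw [Finset.mul_sum]
  simp [mul_assoc]

theorem IsMultilinearIn.sum_list {W : Finset V} (ps : List (MvPolynomial V F))
    (h : ∀ p ∈ ps, IsMultilinearIn W p) : IsMultilinearIn W ps.sum := by
  induction ps with
  | nil => exact IsMultilinearIn.zero W
  | cons p ps ih =>
    rw [List.sum_cons]
    exact (h p (by simp)).add (ih fun q hq => h q (by simp [hq]))

/-- The coefficients of the defining expansion are values on the cube. -/
theorem IsMultilinearIn.eq_zero {W : Finset V} {p : MvPolynomial V F} (hp : IsMultilinearIn W p)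
    (h : ∀ e : V → Bool, MvPolynomial.eval (cubePoint F e) p = 0) : p = 0 := by
  rw [hp]
  simp [h]

theorem eval_linPoly (e : V → F) (i : V × F × F) :
    MvPolynomial.eval e (linPoly i) = i.2.1 + i.2.2 * e i.1 := by
  simp [linPoly]

/-- Write `a + b x = (a + b) x + a (1 - x)` and expand: the coefficient belonging to a subset `s` of
`W` is the value of the product at the indicator of `s`. -/
theorem isMultilinearIn_prod_linPoly (W : Finset V) (g : V → F × F) :
    IsMultilinearIn W (∏ x ∈ W, linPoly (x, g x)) := by
  classical
  have h0 : ∀ x, linPoly (x, g x) = MvPolynomial.C ((g x).1 + (g x).2) * MvPolynomial.X x +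
      MvPolynomial.C (g x).1 * (1 - MvPolynomial.X x) := by
    intro x
    rw [linPoly, MvPolynomial.C_add]
    ring
  unfold IsMultilinearIn
  conv_lhs => rw [Finset.prod_congr rfl fun x _ => h0 x, Finset.prod_add]
  refine Finset.sum_congr (by congr) fun s hs => ?_
  rw [Finset.mem_powerset] at hs
  rw [Finset.prod_mul_distrib, Finset.prod_mul_distrib, map_prod, ← Finset.sdiff_union_inter W s,
    Finset.prod_union (Finset.disjoint_sdiff_inter W s), Finset.inter_eq_right.mpr hs,
    Finset.sdiff_union_of_subset hs]
  have h1 : ∏ x ∈ s, MvPolynomial.eval (cubePoint F fun x => decide (x ∈ s)) (linPoly (x, g x)) =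
      ∏ x ∈ s, ((g x).1 + (g x).2) :=
    Finset.prod_congr rfl fun x hx => by simp [eval_linPoly, cubePoint, hx]
  have h2 : ∏ x ∈ W \ s,
      MvPolynomial.eval (cubePoint F fun x => decide (x ∈ s)) (linPoly (x, g x)) =
      ∏ x ∈ W \ s, (g x).1 :=
    Finset.prod_congr rfl fun x hx => by
      simp [eval_linPoly, cubePoint, (Finset.mem_sdiff.mp hx).2]
  rw [h1, h2, MvPolynomial.C_mul, map_prod, map_prod]
  ring

theorem prod_linPoly_eq_linProd (W : Finset V) (g : V → F × F) :
    ∏ x ∈ W, linPoly (x, g x) = linProd (W.toList.map fun x => (x, g x)) := by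
  rw [linProd, List.map_map, ← Finset.prod_map_toList]
  rfl

theorem IsLinProdSum.prod_linPoly (W : Finset V) (g : V → F × F) :
    IsLinProdSum 1 W.card (∏ x ∈ W, OrderedPC.linPoly (x, g x)) := by
  rw [prod_linPoly_eq_linProd]
  simpa using IsLinProdSum.linProd (W.toList.map fun x => (x, g x))

end Multilinear

/-! ### Short derivations of polynomials vanishing on the Boolean cube. -/

section Cube

variable {F : Type u} [Field F] {V : Type v}
  {Q : Set (MvPolynomial V F)} {K L : ℕ} {S : Set (MvPolynomial V F)}

theorem IsLinProdSum.boolean (x : V) :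
    IsLinProdSum 2 2 (MvPolynomial.X x * (1 - MvPolynomial.X x) : MvPolynomial V F) := by
  simpa using (IsLinProdSum.X x).mul
    ((IsLinProdSum.one.mono le_rfl zero_le_one).sub (IsLinProdSum.X x))

theorem DerivableIn.multiple_of_boolean (a : F) (l : List (V × F × F)) (x : V) (hK : 2 ≤ K)
    (hL : 2 + l.length ≤ L) :
    DerivableIn Q K L (2 * l.length + 2) S
      (MvPolynomial.C a * (linProd l * (MvPolynomial.X x * (1 - MvPolynomial.X x)))) := by
  have h1 := IsLinProdSum.boolean (F := F) x
  refine (C_mul a (linProd_mul l (boolean x (h1.mono hK (by omega))) h1 hK hL) ?_).mono (by omega)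
  exact ((IsLinProdSum.linProd l).mul h1).mono (by omega) (by omega)

/-- Modulo the Boolean axioms, a product of univariate linear polynomials can be made
multilinear. -/
theorem DerivableIn.exists_multilinear (hS : S.Nonempty) (W : Finset V) (l : List (V × F × F))
    (hl : ∀ i ∈ l, i.1 ∈ W) (hK : 2 ≤ K) (hL : l.length + W.card + 2 ≤ L) :
    ∃ g : V → F × F,
      (∀ e : V → Bool, MvPolynomial.eval (cubePoint F e) (∏ x ∈ W, linPoly (x, g x)) =
        MvPolynomial.eval (cubePoint F e) (linProd l)) ∧
      DerivableIn Q K L (l.length * (2 * W.card + 6) + 1) S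
        (linProd l - ∏ x ∈ W, linPoly (x, g x)) := by
  classical
  induction l with
  | nil =>
    have h0 : (∏ x ∈ W, linPoly (x, ((1 : F), (0 : F)))) = 1 := by simp [linPoly]
    refine ⟨fun _ => (1, 0), fun e => by rw [h0]; simp [linProd], ?_⟩
    rw [h0]
    simpa [linProd] using DerivableIn.zero hS
  | cons i l ih =>
    rw [List.length_cons] at hL
    obtain ⟨g, h1, h2⟩ := ih (fun i hi => hl i (by simp [hi])) (by omega)
    have hi : i.1 ∈ W := hl i (by simp)
    obtain ⟨x, a, b⟩ := i
    change x ∈ W at hi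
    -- The new factor `a + b x` is merged into the factor for `x`, with `x ^ 2` replaced by `x`.
    let g' : V → F × F := Function.update g x
      ((g x).1 * a, (g x).1 * b + (g x).2 * a + (g x).2 * b)
    have hg' : ∏ y ∈ W.erase x, linPoly (y, g' y) = ∏ y ∈ W.erase x, linPoly (y, g y) :=
      Finset.prod_congr rfl fun y hy => by
        simp [g', Function.update_of_ne (Finset.ne_of_mem_erase hy)]
    have hx' : g' x = ((g x).1 * a, (g x).1 * b + (g x).2 * a + (g x).2 * b) := by simp [g']
    -- Merging replaces `x ^ 2` by `x` in a single factor, so the error is a scalar times the other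
    -- factors times the Boolean axiom of `x`.
    have hdiff : linPoly (x, a, b) * (∏ y ∈ W, linPoly (y, g y)) - ∏ y ∈ W, linPoly (y, g' y) =
        MvPolynomial.C (-(b * (g x).2)) *
          (linProd ((W.erase x).toList.map fun y => (y, g y)) *
            (MvPolynomial.X x * (1 - MvPolynomial.X x))) := by
      rw [← Finset.mul_prod_erase W _ hi, ← Finset.mul_prod_erase W (fun y => linPoly (y, g' y)) hi,
        hg', prod_linPoly_eq_linProd, hx']
      simp only [linPoly, map_add, map_mul, map_neg]
      ring
    have hder := DerivableIn.multiple_of_boolean (Q := Q) (S := S) (K := K) (L := L)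
      (-(b * (g x).2)) ((W.erase x).toList.map fun y => (y, g y)) x hK (by
        simp only [List.length_map, Finset.length_toList]
        have := Finset.card_erase_le (s := W) (a := x)
        omega)
    rw [← hdiff] at hder
    refine ⟨g', fun e => ?_, ?_⟩
    · have h3 : MvPolynomial.eval (cubePoint F e)
          (linPoly (x, a, b) * (∏ y ∈ W, linPoly (y, g y)) - ∏ y ∈ W, linPoly (y, g' y)) = 0 := by
        rw [hdiff]
        by_cases h : e x <;> simp [cubePoint, h]
      rw [map_sub, map_mul, sub_eq_zero] at h3
      rw [← h3, h1, linProd_cons, map_mul]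
    -- The new factor times the difference from the induction hypothesis, plus the error of the last
    -- merge.
    · have h4 : linProd ((x, a, b) :: l) - ∏ y ∈ W, linPoly (y, g' y) =
          linPoly (x, a, b) * (linProd l - ∏ y ∈ W, linPoly (y, g y)) +
          (linPoly (x, a, b) * (∏ y ∈ W, linPoly (y, g y)) - ∏ y ∈ W, linPoly (y, g' y)) := by
        rw [linProd_cons]
        ring
      have h5 : IsLinProdSum 2 (l.length + W.card) (linProd l - ∏ y ∈ W, linPoly (y, g y)) :=
        ((IsLinProdSum.linProd l).mono le_rfl (by omega)).sub
          ((IsLinProdSum.prod_linPoly W g).mono le_rfl (by omega))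
      have h6 : IsLinProdSum K L (linProd ((x, a, b) :: l) - ∏ y ∈ W, linPoly (y, g' y)) :=
        (((IsLinProdSum.linProd ((x, a, b) :: l)).mono le_rfl
          (by rw [List.length_cons]; omega)).sub
          ((IsLinProdSum.prod_linPoly W g').mono le_rfl (by omega))).mono hK le_rfl
      rw [h4] at h6 ⊢
      refine ((DerivableIn.linPoly_mul (x, a, b) h2 h5 hK (by omega)).add hder h6).mono ?_
      simp only [List.length_map, Finset.length_toList, List.length_cons, add_mul]
      have := Finset.card_erase_le (s := W) (a := x)
      omega

/-- The number of lines that suffice to derive a sum of at most `K` products of at most `L`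
univariate linear polynomials which vanishes on the Boolean cube. -/
def vanishingCost (K L : ℕ) : ℕ :=
  K * (L * (2 * (K * L) + 6) + 3) + 1

/-- All products are made multilinear in one common set `W` of variables. The combination of the
multilinear versions vanishes on the cube and hence identically, so `p` equals the combination of
the differences, each derivable from Boolean axioms. Each difference consists of two products, which
doubles the number of terms. -/
theorem DerivableIn.of_vanishing {K' L' : ℕ} {p : MvPolynomial V F} (hS : S.Nonempty)
    (hp : IsLinProdSum K' L' p)
    (h : ∀ e : V → Bool, MvPolynomial.eval (cubePoint F e) p = 0)
    (hK₂ : 2 ≤ K) (hK : 2 * K' ≤ K) (hL : L' + K' * L' + 2 ≤ L) :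
    DerivableIn Q K L (vanishingCost K' L') S p := by
  classical
  obtain ⟨T, h1, h2, rfl⟩ := hp
  let W : Finset V := (T.flatMap fun t => t.2.map Prod.fst).toFinset
  have hW : W.card ≤ K' * L' := by
    refine (List.toFinset_card_le _).trans ?_
    rw [List.length_flatMap]
    refine (List.sum_le_card_nsmul _ L' ?_).trans ?_
    · intro m hm
      obtain ⟨t, ht, rfl⟩ := List.mem_map.mp hm
      simpa using h2 t ht
    · simpa using Nat.mul_le_mul_right _ h1
  have hTW : ∀ t ∈ T, ∀ i ∈ t.2, i.1 ∈ W := by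
    intro t ht i hi
    simp only [W, List.mem_toFinset, List.mem_flatMap, List.mem_map]
    exact ⟨t, ht, i, hi, rfl⟩
  have hex : ∀ t : F × List (V × F × F), ∃ g : V → F × F, t ∈ T →
      (∀ e : V → Bool, MvPolynomial.eval (cubePoint F e) (∏ x ∈ W, linPoly (x, g x)) =
        MvPolynomial.eval (cubePoint F e) (linProd t.2)) ∧
      DerivableIn Q K L (t.2.length * (2 * W.card + 6) + 1) S
        (linProd t.2 - ∏ x ∈ W, linPoly (x, g x)) := by
    intro t
    by_cases ht : t ∈ T
    · obtain ⟨g, hg⟩ := DerivableIn.exists_multilinear (Q := Q) (K := K) (L := L) hS W t.2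
        (hTW t ht) hK₂ (by have := h2 t ht; omega)
      exact ⟨g, fun _ => hg⟩
    · exact ⟨fun _ => 0, fun h => absurd h ht⟩
  choose g hg using hex
  -- The cancellation is an identity of polynomials, so it costs no derivation lines.
  have hml : (T.map fun t => MvPolynomial.C t.1 * ∏ x ∈ W, linPoly (x, g t x)).sum = 0 := by
    refine IsMultilinearIn.eq_zero (W := W) (IsMultilinearIn.sum_list _ ?_) fun e => ?_
    · intro p hp
      obtain ⟨t, _, rfl⟩ := List.mem_map.mp hp
      exact (isMultilinearIn_prod_linPoly W (g t)).C_mul t.1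
    · rw [← h e, linProdSum, map_list_sum, map_list_sum, List.map_map, List.map_map]
      congr 1
      refine List.map_congr_left fun t ht => ?_
      simp only [Function.comp, map_mul]
      rw [(hg t ht).1 e]
  have hsum : linProdSum T = (T.map fun t =>
      MvPolynomial.C t.1 * (linProd t.2 - ∏ x ∈ W, linPoly (x, g t x))).sum := by
    rw [← add_zero (List.sum _), ← hml, ← List.sum_map_add, linProdSum]
    simp only [mul_sub, sub_add_cancel]
  rw [hsum]
  refine (DerivableIn.sum_list (k := L' * (2 * (K' * L') + 6) + 2) (K' := 2) hS _ ?_ ?_).mono ?_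
  · intro p hp
    obtain ⟨t, ht, rfl⟩ := List.mem_map.mp hp
    have h3 := h2 t ht
    have h4 : IsLinProdSum 2 L (linProd t.2 - ∏ x ∈ W, linPoly (x, g t x)) :=
      ((IsLinProdSum.linProd t.2).mono le_rfl (by omega)).sub
        ((IsLinProdSum.prod_linPoly W (g t)).mono le_rfl (by omega))
    refine ⟨(DerivableIn.C_mul t.1 (hg t ht).2 (h4.mono hK₂ le_rfl)).mono ?_, h4.C_mul _⟩
    rw [add_assoc]
    gcongr
  · rw [List.length_map]
    omega
  · rw [List.length_map, vanishingCost]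
    gcongr

/-- The number of lines that suffice to derive a polynomial that agrees on the Boolean cube with a
combination of two earlier lines. -/
def combinationCost (K₁ L₁ K₂ L₂ : ℕ) : ℕ :=
  2 * (K₁ * (2 * L₁ + 2) + 1) + vanishingCost (K₂ + 2 * (K₁ * K₂)) (L₁ + L₂) + 2

/-- Split `p` into `p - (r₁ q₁ + r₂ q₂)`, which vanishes on the cube, and `r₁ q₁ + r₂ q₂`, which is
obtained by multiplying the given lines. -/
theorem DerivableIn.of_combination {K₁ L₁ K₂ L₂ : ℕ} {p q₁ q₂ r₁ r₂ : MvPolynomial V F}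
    (hq₁S : q₁ ∈ S) (hq₂S : q₂ ∈ S) (hp : IsLinProdSum K₂ L₂ p) (hq₁ : IsLinProdSum K₂ L₂ q₁)
    (hq₂ : IsLinProdSum K₂ L₂ q₂) (hr₁ : IsLinProdSum K₁ L₁ r₁) (hr₂ : IsLinProdSum K₁ L₁ r₂)
    (h : ∀ e : V → Bool, MvPolynomial.eval (cubePoint F e) p =
      MvPolynomial.eval (cubePoint F e) (r₁ * q₁ + r₂ * q₂))
    (hK₂ : 2 ≤ K) (hK : 2 * (K₂ + 2 * (K₁ * K₂)) ≤ K)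
    (hL : (L₁ + L₂) + (K₂ + 2 * (K₁ * K₂)) * (L₁ + L₂) + 2 ≤ L) :
    DerivableIn Q K L (combinationCost K₁ L₁ K₂ L₂) S p := by
  have h0 : p = (p - (r₁ * q₁ + r₂ * q₂)) + (r₁ * q₁ + r₂ * q₂) := by ring
  have hrq : IsLinProdSum (2 * (K₁ * K₂)) (L₁ + L₂) (r₁ * q₁ + r₂ * q₂) :=
    ((hr₁.mul hq₁).add (hr₂.mul hq₂)).mono (by omega) le_rfl
  have hz : IsLinProdSum (K₂ + 2 * (K₁ * K₂)) (L₁ + L₂) (p - (r₁ * q₁ + r₂ * q₂)) :=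
    (hp.mono le_rfl (by omega)).sub hrq
  have d0 := DerivableIn.of_vanishing (Q := Q) ⟨q₁, hq₁S⟩ hz
    (fun e => by rw [map_sub, h e, sub_self]) hK₂ hK hL
  have d1 := DerivableIn.mul_of_mem (Q := Q) (K := K) (L := L) hr₁ hq₁ hq₁S (by omega)
    (by omega) (by omega)
  have d2 := DerivableIn.mul_of_mem (Q := Q) (K := K) (L := L) hr₂ hq₂ hq₂S (by omega)
    (by omega) (by omega)
  rw [h0]
  refine (d0.add (d1.add d2 (hrq.mono (by omega) (by omega))) ?_).mono ?_
  · rw [← h0]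
    exact hp.mono (by omega) (by omega)
  · rw [combinationCost]
    omega

end Cube

/-! ## The polynomial translation of disjunctions of linear equations -/

section Semantics

variable {V : Type v}

/-- The value of a linear form under a Boolean assignment. -/
noncomputable def linVal (e : V → Bool) (a : V →₀ ℤ) : ℤ :=
  Finsupp.linearCombination ℤ (fun x => if e x then (1 : ℤ) else 0) a

/-- The Boolean assignment `e` satisfies the disjunction `D`. -/
def Satisfies (e : V → Bool) (D : LinDisj V) : Prop :=
  ∃ L ∈ D, linVal e L.1 = L.2

theorem linVal_single (e : V → Bool) (x : V) :
    linVal e (Finsupp.single x 1) = if e x then 1 else 0 := by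
  simp [linVal]

theorem linVal_eq_sum (e : V → Bool) (a : V →₀ ℤ) :
    linVal e a = ∑ x ∈ a.support, if e x then a x else 0 := by
  simp [linVal, Finsupp.linearCombination_apply, Finsupp.sum]

theorem literalEq_injective : Function.Injective (literalEq (V := V)) := by
  rintro ⟨x, b⟩ ⟨y, b'⟩ h
  simp only [literalEq, Prod.mk.injEq] at h
  obtain ⟨h1, h2⟩ := h
  have h3 := (Finsupp.single_eq_single_iff _ _ _ _).mp h1
  have h4 : x = y := by simpa using h3
  subst h4
  cases b <;> cases b' <;> simp_all

theorem linDisjSize_mono {A B : LinDisj V} (h : A ⊆ B) : linDisjSize A ≤ linDisjSize B :=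
  Finset.sum_le_sum_of_subset h

variable [DecidableEq V] {e : V → Bool} {A B : LinDisj V} {L L₁ L₂ : LinEq V}

theorem satisfies_insert : Satisfies e (insert L A) ↔ linVal e L.1 = L.2 ∨ Satisfies e A := by
  simp only [Satisfies, Finset.exists_mem_insert]

theorem satisfies_union : Satisfies e (A ∪ B) ↔ Satisfies e A ∨ Satisfies e B := by
  simp only [Satisfies, Finset.mem_union, or_and_right, exists_or]

theorem Satisfies.resolution_add (hA : Satisfies e (insert L₁ A)) (hB : Satisfies e (insert L₂ B)) :
    Satisfies e (insert (L₁ + L₂) (A ∪ B)) := by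
  rw [satisfies_insert] at *
  rw [satisfies_union]
  rcases hA with hA | hA
  · rcases hB with hB | hB
    · left
      simp only [linVal] at *
      rw [Prod.fst_add, Prod.snd_add, map_add, hA, hB]
    · exact .inr (.inr hB)
  · exact .inr (.inl hA)

theorem Satisfies.resolution_sub (hA : Satisfies e (insert L₁ A)) (hB : Satisfies e (insert L₂ B)) :
    Satisfies e (insert (L₁ - L₂) (A ∪ B)) := by
  rw [satisfies_insert] at *
  rw [satisfies_union]
  rcases hA with hA | hA
  · rcases hB with hB | hB
    · left
      simp only [linVal] at *
      rw [Prod.fst_sub, Prod.snd_sub, map_sub, hA, hB]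
    · exact .inr (.inr hB)
  · exact .inr (.inl hA)

theorem Satisfies.simplification {k : ℤ} (hk : k ≠ 0)
    (hA : Satisfies e (insert ((0 : V →₀ ℤ), k) A)) : Satisfies e A := by
  rw [satisfies_insert] at hA
  refine hA.resolve_left fun h => hk ?_
  simpa [linVal] using h.symm

theorem satisfies_boolean (e : V → Bool) (x : V) :
    Satisfies e {(Finsupp.single x 1, 0), (Finsupp.single x 1, 1)} := by
  cases h : e x
  · exact ⟨(Finsupp.single x 1, 0), by simp, by simp [linVal_single, h]⟩
  · exact ⟨(Finsupp.single x 1, 1), by simp, by simp [linVal_single, h]⟩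

theorem satisfies_clauseDisj (e : V → Bool) (κ : Clause V) :
    Satisfies e (clauseDisj κ) ↔ ∃ l ∈ κ, e l.1 = l.2 := by
  simp only [Satisfies, clauseDisj, Finset.exists_mem_image]
  refine exists_congr fun l => and_congr_right fun _ => ?_
  rw [literalEq, linVal_single]
  cases e l.1 <;> cases l.2 <;> simp

/-- Distinct literals give distinct equations, each with a coefficient `1`. This bounds the number
of factors of the clause polynomial by the size of the line. -/
theorem card_le_linDisjSize_clauseDisj (κ : Clause V) : κ.card ≤ linDisjSize (clauseDisj κ) := by
  rw [linDisjSize, clauseDisj, Finset.sum_image fun _ _ _ _ h => literalEq_injective h,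
    Finset.card_eq_sum_ones]
  refine Finset.sum_le_sum fun l _ => ?_
  simp only [linEqSize, literalEq]
  simp [Finsupp.support_single]

end Semantics

/-! ### Lines as short sums of products, by Vandermonde interpolation. -/

section Translation

theorem exists_injective_of_lt_card {F : Type u} {m : ℕ} (h : (m : ℕ∞) < ENat.card F) :
    ∃ t : Fin m → F, Function.Injective t := by
  rw [← Set.encard_univ] at h
  obtain ⟨s, _, hs⟩ := Set.exists_subset_encard_eq h.le
  have hfin : s.Finite := Set.finite_of_encard_eq_coe hs
  have hcard : hfin.toFinset.card = m := by
    rw [hfin.encard_eq_coe_toFinset_card] at hs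
    exact_mod_cast hs
  exact ⟨fun i => (hfin.toFinset.equivFinOfCardEq hcard).symm i, fun i j hij => by
    simpa using hij⟩

variable {F : Type u} [Field F] {V : Type v}

/-- `p` is a sum of products that takes the value `0` at the assignments that satisfy `D`, and `1`
at the others. -/
def Represents (K L : ℕ) (p : MvPolynomial V F) (D : LinDisj V) : Prop :=
  IsLinProdSum K L p ∧
    ∀ e : V → Bool, (Satisfies e D → MvPolynomial.eval (cubePoint F e) p = 0) ∧
      (¬ Satisfies e D → MvPolynomial.eval (cubePoint F e) p = 1)

theorem Represents.mono {K K' L L' : ℕ} {p : MvPolynomial V F} {D : LinDisj V}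
    (h : Represents K L p D) (hK : K ≤ K') (hL : L ≤ L') : Represents K' L' p D :=
  ⟨h.1.mono hK hL, h.2⟩

/-- Any function on `{0, ..., m - 1}` is a linear combination of the exponential functions with
`m` given distinct bases. -/
theorem exists_sum_mul_pow_eq {m : ℕ} {t : Fin m → F} (ht : Function.Injective t) (h : Fin m → F) :
    ∃ α : Fin m → F, ∀ k : Fin m, ∑ j, α j * t j ^ (k : ℕ) = h k := by
  have hdet : IsUnit (Matrix.vandermonde t).det :=
    (Matrix.det_vandermonde_ne_zero_iff.mpr ht).isUnit
  refine ⟨Matrix.vecMul h (Matrix.vandermonde t)⁻¹, fun k => ?_⟩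
  have h1 : Matrix.vecMul (Matrix.vecMul h (Matrix.vandermonde t)⁻¹) (Matrix.vandermonde t) =
      h := by
    rw [Matrix.vecMul_vecMul, Matrix.nonsing_inv_mul _ hdet, Matrix.vecMul_one]
  simpa [Matrix.vecMul, dotProduct, Matrix.vandermonde_apply] using congrFun h1 k

/-- Every function of a linear form is, on the Boolean cube, a short sum of products. -/
theorem exists_isLinProdSum_linVal (a : V →₀ ℤ) {s : ℕ} (ha : ∑ x ∈ a.support, (a x).natAbs ≤ s)
    (hF : ((2 * s + 1 : ℕ) : ℕ∞) < ENat.card F) (h : ℤ → F) :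
    ∃ p : MvPolynomial V F, IsLinProdSum (2 * s + 1) s p ∧
      ∀ e : V → Bool, MvPolynomial.eval (cubePoint F e) p = h (linVal e a) := by
  obtain ⟨t, ht⟩ := exists_injective_of_lt_card hF
  -- Shifting by `∑ |a x|` moves the values of the linear form into `{0, ..., 2s}`.
  obtain ⟨α, hα⟩ := exists_sum_mul_pow_eq ht
    fun k => h ((k : ℕ) - ∑ x ∈ a.support, ((a x).natAbs : ℤ))
  have hcard : a.support.card ≤ s := by
    refine le_trans ?_ ha
    rw [Finset.card_eq_sum_ones]
    refine Finset.sum_le_sum fun x hx => ?_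
    have := Finsupp.mem_support_iff.mp hx
    omega
  -- The factor for `x` is `t ^ |a x|` at `x = 0` and `t ^ (a x + |a x|)` at `x = 1`, so the product
  -- is `t` to the shifted value of the form. Both exponents are nonnegative, so `t = 0` is allowed.
  let g : Fin (2 * s + 1) → V → F × F := fun j x =>
    (t j ^ (a x).natAbs, t j ^ (a x + (a x).natAbs).toNat - t j ^ (a x).natAbs)
  refine ⟨(Finset.univ.toList.map fun j =>
    MvPolynomial.C (α j) * ∏ x ∈ a.support, linPoly (x, g j x)).sum, ?_, fun e => ?_⟩
  · have := IsLinProdSum.sum_list (K := 1) (L := s) (Finset.univ.toList.map fun j =>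
      MvPolynomial.C (α j) * ∏ x ∈ a.support, linPoly (x, g j x)) (by
        intro p hp
        obtain ⟨j, _, rfl⟩ := List.mem_map.mp hp
        exact ((IsLinProdSum.prod_linPoly a.support (g j)).C_mul (α j)).mono le_rfl hcard)
    simpa using this
  · let N : ℕ := ∑ x ∈ a.support, if e x then (a x + (a x).natAbs).toNat else (a x).natAbs
    have hN : (N : ℤ) = linVal e a + ∑ x ∈ a.support, ((a x).natAbs : ℤ) := by
      rw [linVal_eq_sum, ← Finset.sum_add_distrib]
      simp only [N]
      push_cast
      refine Finset.sum_congr rfl fun x _ => ?_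
      split_ifs
      · rw [Int.toNat_of_nonneg]
        linarith [neg_abs_le (a x)]
      · simp
    have hN' : N < 2 * s + 1 := by
      have : N ≤ 2 * ∑ x ∈ a.support, (a x).natAbs := by
        rw [Finset.mul_sum]
        refine Finset.sum_le_sum fun x _ => ?_
        split_ifs <;> omega
      omega
    have h1 := hα ⟨N, hN'⟩
    simp only [hN, add_sub_cancel_right] at h1
    rw [← h1, Finset.sum_map_toList, map_sum]
    refine Finset.sum_congr rfl fun j _ => ?_
    rw [map_mul, MvPolynomial.eval_C, map_prod, ← Finset.prod_pow_eq_pow_sum]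
    congr 1
    refine Finset.prod_congr rfl fun x _ => ?_
    rw [eval_linPoly]
    cases hx : e x <;> simp [g, cubePoint, hx]

theorem isLinProdSum_clausePoly (κ : Clause V) :
    IsLinProdSum 1 κ.card (clausePoly F κ) := by
  have h := IsLinProdSum.prod (K := 1) (L := 1) κ
    (fun l : Literal V => (MvPolynomial.X l.1 - if l.2 then 1 else 0 : MvPolynomial V F))
    fun l _ => by
      convert IsLinProdSum.linPoly (l.1, (if l.2 then (-1 : F) else 0), (1 : F)) using 1
      cases l.2 <;> simp [linPoly, sub_eq_add_neg, add_comm]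
  simpa [clausePoly] using h

variable [DecidableEq V]

/-- The sign that turns the translation of a clause into the indicator of its falsity. -/
def clauseSign (F : Type u) [Field F] (κ : Clause V) : F :=
  ∏ l ∈ κ, if l.2 then -1 else 1

theorem represents_clausePoly (κ : Clause V) :
    Represents 1 κ.card (MvPolynomial.C (clauseSign F κ) * clausePoly F κ) (clauseDisj κ) := by
  refine ⟨(isLinProdSum_clausePoly κ).C_mul _, fun e => ?_⟩
  rw [satisfies_clauseDisj]
  have h0 : MvPolynomial.eval (cubePoint F e)
      (MvPolynomial.C (clauseSign F κ) * clausePoly F κ) =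
      ∏ l ∈ κ, if e l.1 = l.2 then 0 else 1 := by
    rw [map_mul, MvPolynomial.eval_C, clauseSign, clausePoly, map_prod, ← Finset.prod_mul_distrib]
    refine Finset.prod_congr rfl fun l _ => ?_
    rw [map_sub, MvPolynomial.eval_X, cubePoint]
    cases e l.1 <;> cases l.2 <;> simp
  rw [h0]
  constructor
  · rintro ⟨l, hl, h⟩
    exact Finset.prod_eq_zero hl (by simp [h])
  · intro h
    push Not at h
    exact Finset.prod_eq_one fun l hl => by simp [h l hl]

/-- The truth of `E` depends only on the value of its common linear form; interpolation is applied
to the indicator of the values that falsify it. -/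
theorem exists_represents_of_fst_eq {E : LinDisj V} (hE : ∀ L ∈ E, ∀ L' ∈ E, L.1 = L'.1) {s : ℕ}
    (hs : linDisjSize E ≤ s) (hF : ((2 * s + 1 : ℕ) : ℕ∞) < ENat.card F) :
    ∃ p : MvPolynomial V F, Represents (2 * s + 1) s p E := by
  classical
  rcases E.eq_empty_or_nonempty with rfl | ⟨L₀, hL₀⟩
  · exact ⟨1, IsLinProdSum.one.mono (by omega) (by omega), fun e => by simp [Satisfies]⟩
  · have h1 : linEqSize L₀ ≤ linDisjSize E :=
      Finset.single_le_sum (f := linEqSize) (fun _ _ => Nat.zero_le _) hL₀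
    obtain ⟨p, hp, hp'⟩ := exists_isLinProdSum_linVal (F := F) L₀.1 (s := s)
      (by rw [linEqSize] at h1; omega) hF fun k => if (L₀.1, k) ∈ E then 0 else 1
    refine ⟨p, hp, fun e => ?_⟩
    have h2 : Satisfies e E ↔ (L₀.1, linVal e L₀.1) ∈ E := by
      constructor
      · rintro ⟨L, hL, h⟩
        rw [hE L₀ hL₀ L hL, h]
        exact hL
      · exact fun h => ⟨_, h, rfl⟩
    rw [hp', h2]
    exact ⟨fun h => by simp [h], fun h => by simp [h]⟩

/-- `R_{c,d}(lin)`-lines are represented by short sums of products. -/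
theorem IsRcdLine.exists_represents {c d : ℕ} {D : LinDisj V} (hD : IsRcdLine c d D) {s : ℕ}
    (hs : linDisjSize D ≤ s) (hF : ((2 * s + 1 : ℕ) : ℕ∞) < ENat.card F) :
    ∃ p : MvPolynomial V F, Represents ((2 * s + 1) ^ d) (d * s) p D := by
  obtain ⟨_, E, rfl, hE⟩ := hD
  have hs' : ∀ i, linDisjSize (E i) ≤ s := fun i =>
    (linDisjSize_mono (Finset.subset_biUnion_of_mem E (Finset.mem_univ i))).trans hs
  have hex : ∀ i, ∃ p : MvPolynomial V F, Represents (2 * s + 1) s p (E i) := by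
    intro i
    rcases hE i with h | ⟨κ, h⟩
    · exact exists_represents_of_fst_eq h (hs' i) hF
    · rw [h]
      have h1 := card_le_linDisjSize_clauseDisj κ
      have h2 := hs' i
      rw [h] at h2
      exact ⟨_, (represents_clausePoly κ).mono (by omega) (h1.trans h2)⟩
  choose p hp using hex
  have hsat : ∀ e, Satisfies e (Finset.univ.biUnion E) ↔ ∃ i, Satisfies e (E i) := by
    intro e
    simp only [Satisfies, Finset.mem_biUnion, Finset.mem_univ, true_and]
    constructor
    · rintro ⟨L, ⟨i, hL⟩, h⟩
      exact ⟨i, L, hL, h⟩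
    · rintro ⟨i, L, hL, h⟩
      exact ⟨L, ⟨i, hL⟩, h⟩
  -- A disjunction is false exactly when all its parts are, so the indicators of falsity multiply.
  refine ⟨∏ i, p i, by simpa using IsLinProdSum.prod Finset.univ p fun i _ => (hp i).1,
    fun e => ?_⟩
  rw [hsat, map_prod]
  constructor
  · rintro ⟨i, hi⟩
    exact Finset.prod_eq_zero (Finset.mem_univ i) (((hp i).2 e).1 hi)
  · intro h
    push Not at h
    exact Finset.prod_eq_one fun i _ => ((hp i).2 e).2 (h i)

end Translation

/-! ### Simulation of the R(lin) rules. -/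

section Simulation

variable {F : Type u} [Field F] {V : Type v}

/-- The number of lines that suffice to simulate one step of an `R(lin)` proof whose lines are
represented by sums of at most `K` products of at most `L` linear polynomials. -/
def stepCost (K L : ℕ) : ℕ :=
  combinationCost (K * (K + 1)) (2 * L) K L + 1

/-- The number of products needed in the simulation of one step. -/
def stepTerms (K : ℕ) : ℕ :=
  2 * (K + 2 * (K * (K + 1) * K))

/-- The number of factors of the products needed in the simulation of one step. -/
def stepFactors (K L : ℕ) : ℕ :=
  (2 * L + L) + (K + 2 * (K * (K + 1) * K)) * (2 * L + L) + 2

theorem linDisjSize_le_rlinSize {D : LinDisj V} {P : List (LinDisj V)} (h : D ∈ P) :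
    linDisjSize D ≤ rlinSize P :=
  List.le_sum_of_mem (List.mem_map_of_mem h)

theorem DerivableIn.of_represents {Q : Set (MvPolynomial V F)} {S : Set (MvPolynomial V F)}
    {K L : ℕ} {pA pB pC : MvPolynomial V F} {A B C : LinDisj V} (hA : Represents K L pA A)
    (hB : Represents K L pB B) (hC : Represents K L pC C) (hAS : pA ∈ S) (hBS : pB ∈ S)
    (h : ∀ e, Satisfies e A → Satisfies e B → Satisfies e C) (hK : 1 ≤ K) :
    DerivableIn Q (stepTerms K) (stepFactors K L)
      (combinationCost (K * (K + 1)) (2 * L) K L) S pC := by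
  have hKK : K ≤ K * (K + 1) := Nat.le_mul_of_pos_right _ (Nat.succ_pos _)
  -- On the cube, `pC = pC * pA + pC * (1 - pA) * pB`: where `C` fails, either `A` fails and the
  -- first summand is `1`, or `A` holds, `B` fails and the second one is.
  refine DerivableIn.of_combination (r₁ := pC) (r₂ := pC * (1 - pA)) hAS hBS hC.1 hA.1 hB.1
    (hC.1.mono hKK (by omega)) ?_ (fun e => ?_) ?_ le_rfl le_rfl
  · exact (hC.1.mul ((IsLinProdSum.one.mono le_rfl (Nat.zero_le _)).sub hA.1)).mono
      (by rw [add_comm 1 K]) (by omega)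
  · by_cases h1 : Satisfies e C
    · simp [(hC.2 e).1 h1]
    · by_cases h2 : Satisfies e A
      · have h3 : ¬ Satisfies e B := fun h3 => h1 (h e h2 h3)
        simp [(hC.2 e).2 h1, (hA.2 e).1 h2, (hB.2 e).2 h3]
      · simp [(hC.2 e).2 h1, (hA.2 e).2 h2]
  · rw [stepTerms]
    omega

variable [DecidableEq V]

/-- The inference rules enter only through their soundness on Boolean assignments; a rule with one
premise uses it twice. For an axiom, `M D` need not be the polynomial given by PC, but is related to
it on the cube. -/
theorem DerivableIn.of_rlinStep {Γ : CNF V} {K L : ℕ} (hK : 2 ≤ K) (hL : 2 ≤ L)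
    {M : LinDisj V → MvPolynomial V F} {l : List (LinDisj V)} {D : LinDisj V}
    (hl : ∀ A ∈ l, Represents K L (M A) A) (hD : Represents K L (M D) D)
    (hDL : linDisjSize D ≤ L) (hstep : RLinStep {D | ∃ κ ∈ Γ, D = clauseDisj κ} l D) :
    DerivableIn (cnfPolys F Γ) (stepTerms K) (stepFactors K L) (stepCost K L)
      {p | ∃ A ∈ l, M A = p} (M D) := by
  have hK' : K ≤ stepTerms K := by rw [stepTerms]; omega
  have hL' : L ≤ stepFactors K L := by rw [stepFactors]; omega
  have hmem : ∀ A ∈ l, M A ∈ {p | ∃ A ∈ l, M A = p} := fun A hA => ⟨A, hA, rfl⟩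
  have hKK : 1 ≤ K * (K + 1) := Nat.mul_pos (by omega) (Nat.succ_pos _)
  cases hstep with
  | initial h =>
    obtain ⟨κ, hκ, rfl⟩ := h
    have hcard := (card_le_linDisjSize_clauseDisj κ).trans hDL
    have hlp : IsLinProdSum K L (clausePoly F κ) :=
      (isLinProdSum_clausePoly κ).mono (by omega) hcard
    -- The extra line in `stepCost` is the axiom itself.
    rw [stepCost, add_comm]
    refine (DerivableIn.initial (Q := cnfPolys F Γ) ⟨κ, hκ, rfl⟩ (hlp.mono hK' hL')).trans ?_
    refine DerivableIn.of_combination (r₁ := MvPolynomial.C (clauseSign F κ)) (r₂ := 0)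
      (Set.mem_insert _ _) (Set.mem_insert _ _) hD.1 hlp hlp
      ((IsLinProdSum.C _).mono hKK (Nat.zero_le _)) .zero (fun e => ?_) (by omega) le_rfl le_rfl
    rw [zero_mul, add_zero]
    have hr := (represents_clausePoly (F := F) κ).2 e
    by_cases h : Satisfies e (clauseDisj κ)
    · rw [hr.1 h, (hD.2 e).1 h]
    · rw [hr.2 h, (hD.2 e).2 h]
  | boolean x =>
    have hlp : IsLinProdSum K L
        (MvPolynomial.X x * (1 - MvPolynomial.X x) : MvPolynomial V F) :=
      (IsLinProdSum.boolean x).mono hK hL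
    rw [stepCost, add_comm]
    refine (DerivableIn.boolean x (hlp.mono hK' hL')).trans ?_
    -- `M D` vanishes on the cube; the axiom line only serves to make the set of available lines
    -- nonempty.
    refine DerivableIn.of_combination (r₁ := 0) (r₂ := 0) (Set.mem_insert _ _)
      (Set.mem_insert _ _) hD.1 hlp hlp .zero .zero (fun e => ?_) (by omega) le_rfl le_rfl
    simp [(hD.2 e).1 (satisfies_boolean e x)]
  | resolution_add hA hB =>
    exact (DerivableIn.of_represents (hl _ hA) (hl _ hB) hD (hmem _ hA) (hmem _ hB)
      (fun _ => Satisfies.resolution_add) (by omega)).mono (Nat.le_succ _)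
  | resolution_sub hA hB =>
    exact (DerivableIn.of_represents (hl _ hA) (hl _ hB) hD (hmem _ hA) (hmem _ hB)
      (fun _ => Satisfies.resolution_sub) (by omega)).mono (Nat.le_succ _)
  | weakening E hA =>
    exact (DerivableIn.of_represents (hl _ hA) (hl _ hA) hD (hmem _ hA) (hmem _ hA)
      (fun _ h _ => satisfies_insert.mpr (.inr h)) (by omega)).mono (Nat.le_succ _)
  | simplification hk hA =>
    exact (DerivableIn.of_represents (hl _ hA) (hl _ hA) hD (hmem _ hA) (hmem _ hA)
      (fun _ h _ => h.simplification hk) (by omega)).mono (Nat.le_succ _)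

/-- Since `M` depends on the disjunction and not on its position, a repeated line costs nothing.
Counting distinct lines is essential: lines of size zero can be repeated without increasing the size
of the refutation. -/
theorem exists_isBoundedPCSeq {Γ : CNF V} {K L : ℕ} (hK : 2 ≤ K) (hL : 2 ≤ L)
    {M : LinDisj V → MvPolynomial V F} {P : List (LinDisj V)}
    (hM : ∀ D ∈ P, Represents K L (M D) D) (hPL : ∀ D ∈ P, linDisjSize D ≤ L)
    (hstep : ∀ (l : List (LinDisj V)) (D : LinDisj V) (r : List (LinDisj V)), P = l ++ D :: r →
      RLinStep {D | ∃ κ ∈ Γ, D = clauseDisj κ} l D) :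
    ∃ π : List (MvPolynomial V F),
      IsBoundedPCSeq (cnfPolys F Γ) (stepTerms K) (stepFactors K L) π ∧
      (∀ D ∈ P, M D ∈ π) ∧ π.length ≤ P.toFinset.card * stepCost K L := by
  induction P using List.reverseRecOn with
  | nil => exact ⟨[], fun l a r h => by simp at h, by simp, by simp⟩
  | append_singleton l D ih =>
    obtain ⟨π, h1, h2, h3⟩ := ih (fun A hA => hM A (by simp [hA]))
      (fun A hA => hPL A (by simp [hA]))
      (fun l' A r h => hstep l' A (r ++ [D]) (by rw [h, List.append_assoc, List.cons_append]))
    by_cases hDl : D ∈ l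
    · refine ⟨π, h1, fun A hA => ?_, h3.trans (Nat.mul_le_mul_right _ (Finset.card_le_card ?_))⟩
      · rcases List.mem_append.mp hA with h | h
        · exact h2 A h
        · rw [List.mem_singleton.mp h]
          exact h2 D hDl
      · intro A hA
        simp only [List.mem_toFinset, List.mem_append] at hA ⊢
        exact .inl hA
    · have hder := DerivableIn.of_rlinStep hK hL (fun A hA => hM A (by simp [hA]))
        (hM D (by simp)) (hPL D (by simp)) (hstep l D [] rfl)
      obtain ⟨r, h4, h5, h6⟩ := hder π h1 (by
        rintro q ⟨A, hA, rfl⟩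
        exact h2 A hA)
      refine ⟨π ++ r, h5, fun A hA => ?_, ?_⟩
      · rcases List.mem_append.mp hA with h | h
        · exact List.mem_append_left _ (h2 A h)
        · rw [List.mem_singleton.mp h]
          exact h6
      · rw [List.toFinset_append, List.toFinset_cons, List.toFinset_nil, insert_empty_eq,
          Finset.card_union_of_disjoint (by simpa using hDl), Finset.card_singleton,
          List.length_append]
        linarith

/-- A proof has few distinct lines: only two disjunctions have size zero. -/
theorem card_toFinset_le (P : List (LinDisj V)) : P.toFinset.card ≤ rlinSize P + 2 := by
  have hzero : ∀ D : LinDisj V, linDisjSize D = 0 → D ∈ ({∅, {0}} : Finset (LinDisj V)) := by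
    intro D hD
    have hsub : D ⊆ {0} := by
      intro E hE
      have h1 : linEqSize E = 0 := Finset.sum_eq_zero_iff.mp hD E hE
      rw [linEqSize, Nat.add_eq_zero_iff, Finset.sum_eq_zero_iff] at h1
      rw [Finset.mem_singleton]
      refine Prod.ext (Finsupp.ext fun x => ?_) (Int.natAbs_eq_zero.mp h1.2)
      by_contra hx
      exact hx (Int.natAbs_eq_zero.mp (h1.1 x (Finsupp.mem_support_iff.mpr hx)))
    rw [Finset.subset_singleton_iff] at hsub
    simpa using hsub
  have h1 : ∑ D ∈ P.toFinset, linDisjSize D ≤ rlinSize P := by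
    have h0 : P.dedup.toFinset = P.toFinset := by ext; simp
    rw [← h0, List.sum_toFinset linDisjSize P.nodup_dedup]
    exact (P.dedup_sublist.map linDisjSize).sum_le_sum fun _ _ => Nat.zero_le _
  have h2 : (P.toFinset.filter fun D => linDisjSize D ≠ 0).card ≤
      ∑ D ∈ P.toFinset, linDisjSize D := by
    rw [Finset.card_filter]
    refine Finset.sum_le_sum fun D _ => ?_
    split_ifs <;> omega
  have h3 : (P.toFinset.filter fun D => ¬ linDisjSize D ≠ 0).card ≤ 2 :=
    (Finset.card_le_card fun D hD => hzero D (by simpa using (Finset.mem_filter.mp hD).2)).trans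
      Finset.card_le_two
  have h4 := Finset.card_filter_add_card_filter_not (s := P.toFinset) fun D => linDisjSize D ≠ 0
  omega

end Simulation

/-! ### Assembly of the refutation and its size. -/

section Formulas

variable {F : Type u} [Field F] {V : Type v} [LinearOrder V]

theorem exists_formulas {K L : ℕ} (π : List (MvPolynomial V F))
    (h : ∀ p ∈ π, IsLinProdSum K L p) :
    ∃ φ : List (Formula F V), List.Forall₂ Formula.OrderedComputes φ π ∧
      (∀ f ∈ φ, f.IsSigmaPiSigma) ∧ ofpcSize φ ≤ π.length * (K * (6 * L + 2) + 3) := by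
  induction π with
  | nil => exact ⟨[], .nil, by simp, by simp [ofpcSize]⟩
  | cons p π ih =>
    obtain ⟨φ, h1, h2, h3⟩ := ih fun q hq => h q (by simp [hq])
    obtain ⟨f, h4, h5, h6⟩ := (h p (by simp)).exists_formula
    refine ⟨f :: φ, .cons h5 h1, by simpa using ⟨h4, h2⟩, ?_⟩
    rw [List.length_cons]
    simp only [ofpcSize, List.map_cons, List.sum_cons] at h3 ⊢
    linarith

theorem exists_ofpcRefutation {Γ : CNF V} {c d : ℕ} {P : List (LinDisj V)}
    (hP : IsR0Refutation c d Γ P) {s K L : ℕ} (hs : rlinSize P = s)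
    (hF : ((2 * s + 1 : ℕ) : ℕ∞) < ENat.card F)
    (hK : K = (2 * s + 1) ^ d + 1) (hL : L = d * s + s + 2) :
    ∃ φ : List (Formula F V), IsOFPCRefutation (cnfPolys F Γ) φ ∧ (∀ f ∈ φ, f.IsSigmaPiSigma) ∧
      ofpcSize φ ≤ ((s + 2) * stepCost K L + combinationCost (K * (K + 1)) (2 * L) K L + 1) *
        (stepTerms K * (6 * stepFactors K L + 2) + 3) := by
  obtain ⟨⟨hlast, hstep⟩, hlines⟩ := hP
  -- The summand `1` in `K` and the summands `s + 2` in `L` leave room for Boolean axioms and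
  -- initial clauses, also when `d = 0`.
  have hK2 : 2 ≤ K := by
    have : 0 < (2 * s + 1) ^ d := by positivity
    omega
  have hL2 : 2 ≤ L := by omega
  have hex : ∀ D : LinDisj V, ∃ p : MvPolynomial V F, D ∈ P → Represents K L p D := by
    intro D
    by_cases hD : D ∈ P
    · obtain ⟨p, hp⟩ := (hlines D hD).exists_represents (hs ▸ linDisjSize_le_rlinSize hD) hF
      exact ⟨p, fun _ => hp.mono (by omega) (by omega)⟩
    · exact ⟨0, fun h => absurd h hD⟩
  choose M hM using hex
  obtain ⟨π, h1, h2, h3⟩ := exists_isBoundedPCSeq (Γ := Γ) hK2 hL2 hM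
    (fun D hD => (linDisjSize_le_rlinSize hD).trans (by omega)) hstep
  have hempty : ∅ ∈ P := List.mem_of_getLast? hlast
  -- `M ∅` is `1` on the cube but possibly not as a polynomial; one further simulated step turns it
  -- into `1`.
  have hone : Represents K L (1 : MvPolynomial V F) ∅ :=
    ⟨IsLinProdSum.one.mono (by omega) (Nat.zero_le _), fun e => by simp [Satisfies]⟩
  have hder := DerivableIn.of_represents (Q := cnfPolys F Γ) (hM _ hempty) (hM _ hempty) hone
    (Set.mem_singleton (M ∅)) (Set.mem_singleton _) (fun _ h _ => h) (by omega)
  obtain ⟨r, h4, h5, h6⟩ := hder π h1 fun q hq => by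
    rw [Set.mem_singleton_iff.mp hq]
    exact h2 ∅ hempty
  -- The line `1` may already occur earlier, so it is repeated at the end as `1 * 1 + 0 * 1`.
  have h7 : IsBoundedPCSeq (cnfPolys F Γ) (stepTerms K) (stepFactors K L) (π ++ r ++ [1]) := by
    refine h5.concat ?_ (IsLinProdSum.one.mono ?_ (Nat.zero_le _))
    · simpa using PCStep.addition (Q := cnfPolys F Γ) 1 0 h6 h6
    · rw [stepTerms]
      omega
  obtain ⟨φ, h8, h9, h10⟩ := exists_formulas (π ++ r ++ [1]) fun p hp => by
    obtain ⟨l, r', h⟩ := List.append_of_mem hp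
    exact (h7 l p r' h).2
  refine ⟨φ, ⟨π ++ r ++ [1], ⟨by simp, fun l a r' h => (h7 l a r' h).1⟩, h8⟩, h9, h10.trans ?_⟩
  refine Nat.mul_le_mul_right _ ?_
  rw [List.length_append, List.length_append, List.length_singleton]
  have h11 := h3.trans (Nat.mul_le_mul_right _ (card_toFinset_le P))
  rw [hs] at h11
  omega

end Formulas

/-! ## Polynomial bounds -/

/-- Functions on the natural numbers given by polynomials with natural coefficients. -/
def IsPolynomial (f : ℕ → ℕ) : Prop :=
  ∃ p : Polynomial ℕ, ∀ s, p.eval s = f s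

namespace IsPolynomial

variable {f g h k : ℕ → ℕ}

theorem const (n : ℕ) : IsPolynomial fun _ => n := ⟨.C n, by simp⟩

theorem id : IsPolynomial fun s => s := ⟨.X, by simp⟩

theorem add (hf : IsPolynomial f) (hg : IsPolynomial g) : IsPolynomial fun s => f s + g s := by
  obtain ⟨p, hp⟩ := hf
  obtain ⟨q, hq⟩ := hg
  exact ⟨p + q, by simp [hp, hq]⟩

theorem mul (hf : IsPolynomial f) (hg : IsPolynomial g) : IsPolynomial fun s => f s * g s := by
  obtain ⟨p, hp⟩ := hf
  obtain ⟨q, hq⟩ := hg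
  exact ⟨p * q, by simp [hp, hq]⟩

theorem pow (hf : IsPolynomial f) (n : ℕ) : IsPolynomial fun s => f s ^ n := by
  obtain ⟨p, hp⟩ := hf
  exact ⟨p ^ n, by simp [hp]⟩

theorem vanishingCost (hf : IsPolynomial f) (hg : IsPolynomial g) :
    IsPolynomial fun s => vanishingCost (f s) (g s) :=
  (hf.mul ((hg.mul (((const 2).mul (hf.mul hg)).add (const 6))).add (const 3))).add (const 1)

theorem combinationCost (hf : IsPolynomial f) (hg : IsPolynomial g) (hh : IsPolynomial h)
    (hk : IsPolynomial k) :
    IsPolynomial fun s => combinationCost (f s) (g s) (h s) (k s) :=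
  (((const 2).mul ((hf.mul (((const 2).mul hg).add (const 2))).add (const 1))).add
    (vanishingCost (hh.add ((const 2).mul (hf.mul hh))) (hg.add hk))).add (const 2)

theorem stepTerms (hf : IsPolynomial f) : IsPolynomial fun s => stepTerms (f s) :=
  (const 2).mul (hf.add ((const 2).mul ((hf.mul (hf.add (const 1))).mul hf)))

theorem stepFactors (hf : IsPolynomial f) (hg : IsPolynomial g) :
    IsPolynomial fun s => stepFactors (f s) (g s) :=
  ((((const 2).mul hg).add hg).add
    ((hf.add ((const 2).mul ((hf.mul (hf.add (const 1))).mul hf))).mul (((const 2).mul hg).add hg))).add (const 2)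

end IsPolynomial

end OrderedPC

open OrderedPC in
theorem exists_polynomial_ofpcSize_bound (d : ℕ) :
    ∃ p : Polynomial ℕ, ∀ s K L : ℕ, K = (2 * s + 1) ^ d + 1 → L = d * s + s + 2 →
      p.eval s = ((s + 2) * stepCost K L + combinationCost (K * (K + 1)) (2 * L) K L + 1) *
        (stepTerms K * (6 * stepFactors K L + 2) + 3) := by
  have hK : IsPolynomial fun s => (2 * s + 1) ^ d + 1 :=
    ((((IsPolynomial.const 2).mul .id).add (.const 1)).pow d).add (.const 1)
  have hL : IsPolynomial fun s => d * s + s + 2 :=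
    (((IsPolynomial.const d).mul .id).add .id).add (.const 2)
  have hC := (hK.mul (hK.add (.const 1))).combinationCost ((IsPolynomial.const 2).mul hL) hK hL
  obtain ⟨p, hp⟩ := ((((IsPolynomial.id.add (.const 2)).mul (hC.add (.const 1))).add hC).add
    (.const 1)).mul ((hK.stepTerms.mul (((IsPolynomial.const 6).mul (hK.stepFactors hL)).add
      (.const 2))).add (.const 3))
  refine ⟨p, fun s K L hK hL => ?_⟩
  rw [hp, hK, hL, stepCost]

theorem theorem5p4 (c d : ℕ) :
    ∃ p q : Polynomial ℕ,
      ∀ (F : Type*) [Field F] (V : Type*) [LinearOrder V]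
        (K : OrderedPC.CNF V) (P : List (OrderedPC.LinDisj V)),
        OrderedPC.IsR0Refutation c d K P →
        ((q.eval (OrderedPC.rlinSize P) : ℕ) : ℕ∞) < ENat.card F →
        ∃ φ : List (OrderedPC.Formula F V),
          OrderedPC.IsOFPCRefutation (OrderedPC.cnfPolys F K) φ ∧
          (∀ f ∈ φ, f.IsSigmaPiSigma) ∧
          OrderedPC.ofpcSize φ ≤ p.eval (OrderedPC.rlinSize P) := by
  obtain ⟨p, hp⟩ := exists_polynomial_ofpcSize_bound d
  -- The field bound provides the `2s + 1` interpolation nodes.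
  refine ⟨p, 2 * .X + 1, fun F _ V _ K P hP hF => ?_⟩
  rw [hp _ _ _ rfl rfl]
  exact OrderedPC.exists_ofpcRefutation hP rfl (by simpa using hF) rfl rfl
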